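/- **Setting.** Consider a finite Markov decision process with state space $S$, action space $A$, transition probabilities $P_{\rm env}(s'|s,a)$, rewards $r(s,a)$, $r_{\max}=\max|r(s,a)|$, and a fixed policy $\pi$. Let $P(s'|s)=\sum_a P_{\rm env}(s'|s,a)\pi(a|s)$ and $R=(r_s)_s$ with $r_s=\sum_a\pi(a|s)r(s,a)$. Assume $P$ is irreducible and aperiodic, with stationary distribution $\mu$, and let $C>1$, $b\in[0,1)$ be such that $\|P^k(\cdot|s)-\mu\|_1\le Cb^k$ for all $k\ge0$, $s\in S$. Let $\Phi\in\mathbb R^{S\times d}$ have linearly independent columns and rows $\phi(s)^\top$ with $\|\phi(s)\|\le1$, let $D=\mathrm{diag}(\mu)$, and $$\eta=\min_{\|x\|=1}\ \tfrac12\sum_{s,s'}\mu(s)P(s'|s)\big((\Phi x)(s)-(\Phi x)(s')\big)^2+(\mu^\top\Phi x)^2,\qquad \eta'=\lambda_{\min}(\Phi^\top D\Phi).$$ Let $w^*=\Phi^\top\mu$ and let $\theta^*$ be the solution of $\Phi^\top D(R+P\Phi\theta^*-\Phi\theta^*)-\mu^\top(R+\Phi\theta^*)\,w^*=0$. The single-chain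 algorithm runs along a trajectory $s_0,s_1,\dots$ of the Markov chain $P$ (arbitrary law of $s_0$): $$w_{t+1}=\mathrm{Proj}_{R_w}\{w_t+\beta_t(\phi(s_t)-w_t)\},$$ $$\theta_{t+1}=\mathrm{Proj}_{R_\theta}\big\{\theta_t+\alpha_t\big[(r_{s_t}+\phi(s_{t+1})^\top\theta_t-\phi(s_t)^\top\theta_t)\phi(s_t)-(r_{s_t}+\phi(s_t)^\top\theta_t)w_t\big]\big\},$$ where $\mathrm{Proj}_\rho$ is the Euclidean projection onto the closed ball of radius $\rho$ about $0$, $R_w\ge1$, $R_\theta>0$, $\|\theta^*\|\le R_\theta$, $\|w_0\|\le1$, $\|\theta_0\|\le R_\theta$, and $$\alpha_t=\frac{a}{(t+c_0)^\xi},\qquad\beta_t=\rho_0\alpha_t,\qquad a>0,\ \rho_0\in(0,1],\ \xi\in(0,1].$$ For $\lambda>0$ and $T\in\mathbb N$ put $c_{1,\lambda}=\eta-\tfrac12\lambda^2(r_{\max}+2R_\theta)$, $c_{2,\lambda}=(r_{\max}+2R_\theta)/\lambda^2$, $L_1=\max\{1,\frac{\log C+1}{\log(1/b)}\}$ (which is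 $1$ if $b=0$), $$G_1(T)=\big(4(28+8\rho_0)L_1(\log(T+c_0)-\log a+1)+4\big)(r_{\max}+3R_\theta)^2,$$ $$G_2(T)=64L_1\big(\log(T+c_0)-\log(\rho_0a)+1\big)+12,\qquad \Gamma_0=\frac{4a^2}{1-ac_{1,\lambda}},$$ $$\Gamma_1=\begin{cases}\frac{2^{ac_{1,\lambda}}ac_{2,\lambda}}{2\rho_0a-ac_{1,\lambda}}\Big(4(\tau+c_0)^{2\rho_0a}+\frac{4\rho_0^2a^2}{1-2\rho_0a}G_2(T)\Big),&\rho_0a<\tfrac12,\\[1mm] \frac{4ac_{2,\lambda}}{1-ac_{1,\lambda}}\Big(4(\tau+c_0)^{2\rho_0a}+4\rho_0^2a^2\log(T+c_0)\,G_2(T)\Big),&\rho_0a=\tfrac12,\\[1mm] \frac{4ac_{2,\lambda}}{1-ac_{1,\lambda}}\Big(4(\tau+c_0)^{2\rho_0a}+\frac{4e\rho_0^2a^2}{2\rho_0a-1}G_2(T)\Big),&\rho_0a>\tfrac12,\end{cases}$$ and $\Delta_T=(T+c_0)^{1-\xi}-(\tau+c_0)^{1-\xi}$. Here $\tau$ is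 any integer with $\tau_{\rm mix}\le\tau\le T$ (for instance $\tau=\tau_{\rm mix}$), where $\tau_{\rm mix}=\tau_{\rm mix}(\beta_T)$ is the least $k$ with $\max_s\|P^k(\cdot|s)-\mu\|_1\le\beta_T$. **Theorem.** There is an absolute constant $M>0$, and for all $a,\rho_0,\xi,C,b$ as above there is a threshold $\bar c>0$ depending only on $a,\rho_0,\xi,C,b$, such that for every such problem, every $\lambda>0$, every $c_0\ge\bar c$ and all $\tau_{\rm mix}\le\tau\le T$: 1. If $\xi\in(0,1)$, $\lambda^2<\frac{2\eta}{r_{\max}+2R_\theta}$ and $c_0\ge\max\Big\{\big(\frac{\xi}{ac_{1,\lambda}}\big)^{\frac1{1-\xi}},\big(\frac{\xi}{\rho_0a}\big)^{\frac1{1-\xi}}\Big\}$, then $$\mathbb E\|\theta_T-\theta^*\|^2\le 4R_\theta^2\exp\Big(-\frac{ac_{1,\lambda}}{1-\xi}\Delta_T\Big)+\frac{a\big(G_1(T)+\rho_0c_{2,\lambda}G_2(T)\big)}{c_{1,\lambda}(T+c_0)^\xi}+\frac{4ac_{2,\lambda}}{1-\xi}\exp\Big(\frac{ac_{1,\lambda}}{c_0^\xi}\Big)\Delta_T\exp\Big(-\frac{a}{1-\xi}\min\{c_{1,\lambda},2\rho_0\}\Delta_T\Big).$$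 2. If $\xi=1$, $a\eta<1$, $\lambda^2\le\frac{2\eta}{r_{\max}+2R_\theta}$ and $\lambda^2>\frac{2\eta-4\rho_0}{r_{\max}+2R_\theta}$, then $$\mathbb E\|\theta_T-\theta^*\|^2\le4R_\theta^2\Big(\frac{\tau+c_0}{T+c_0}\Big)^{ac_{1,\lambda}}+\frac{\Gamma_1+\Gamma_0G_1(T)}{(T+c_0)^{ac_{1,\lambda}}}.$$ 3. (Condition-number dependence.) If $\lambda^2=\frac{\eta}{r_{\max}+2R_\theta}$ and $K\ge1$ satisfies $r_{\max}\le K$, $R_\theta\le K/\sqrt{\eta'}$ and $a\le K/\eta$, then the coefficient of $(T+c_0)^{-\xi}$ in part 1 satisfies $$\frac{a\big(G_1(T)+\rho_0c_{2,\lambda}G_2(T)\big)}{c_{1,\lambda}}\le\frac{M K^3L_1\big(\log(T+c_0)-\log(\rho_0a)+1\big)}{\eta'\,\eta^{3}},$$ and if moreover $\eta\le K\eta'$, it is at most $M K^4L_1\big(\log(T+c_0)-\log(\rho_0a)+1\big)\,\eta^{-4}$. -/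

import Mathlib

open MeasureTheory Matrix

noncomputable section

namespace SingleChainTD

/-- A finite Markov decision process with a fixed (stochastic) policy and a feature matrix.
`env s a s'` is the probability of moving from `s` to `s'` under action `a`, `policy s a` is the
probability of taking action `a` in state `s`, `reward s a` is the reward, and the rows of `Φ`
are the feature vectors of the states. -/
structure Model (S A : Type*) [Fintype S] [Fintype A] (d : ℕ) where
  env : S → A → S → ℝ
  env_nonneg : ∀ s a s', 0 ≤ env s a s'
  env_sum : ∀ s a, ∑ s', env s a s' = 1
  policy : S → A → ℝ
  policy_nonneg : ∀ s a, 0 ≤ policy s a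
  policy_sum : ∀ s, ∑ a, policy s a = 1
  reward : S → A → ℝ
  Φ : Matrix S (Fin d) ℝ

/-- Aperiodicity of a finite transition matrix: for every state, the greatest common divisor of
the lengths of the possible returns to that state is `1`. -/
def IsAperiodic {S : Type*} [Fintype S] [DecidableEq S] (P : Matrix S S ℝ) : Prop :=
  ∀ (i : S) (k : ℕ), (∀ n : ℕ, 1 ≤ n → 0 < (P ^ n) i i → k ∣ n) → k = 1

/-- `μ` is a stationary probability distribution of the transition matrix `P`. -/
structure IsStationaryDist {S : Type*} [Fintype S] (P : Matrix S S ℝ) (μ : S → ℝ) : Prop where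
  nonneg : ∀ s, 0 ≤ μ s
  sum_eq_one : ∑ s, μ s = 1
  invariant : μ ᵥ* P = μ

/-- `‖p_k(· | s) - μ‖₁`, the `ℓ¹` distance to `μ` of the law after `k` steps started at `s`. -/
def mixDist {S : Type*} [Fintype S] [DecidableEq S] (P : Matrix S S ℝ) (μ : S → ℝ)
    (k : ℕ) (s : S) : ℝ :=
  ∑ s', |(P ^ k) s s' - μ s'|

/-- The mixing time at accuracy `ε`: the least `k` such that the law after `k` steps is within
`ε` of `μ` in `ℓ¹`, for every starting state. -/
def mixingTime {S : Type*} [Fintype S] [DecidableEq S] (P : Matrix S S ℝ) (μ : S → ℝ)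
    (ε : ℝ) : ℕ :=
  sInf {k : ℕ | ∀ s, mixDist P μ k s ≤ ε}

/-- The `S`-valued process `s` is a Markov chain with transition matrix `P` under `ℙ`
(the initial law is arbitrary). -/
structure IsMarkovChain {S Ω : Type*} [MeasurableSpace Ω] (P : Matrix S S ℝ)
    (ℙ : Measure Ω) (s : ℕ → Ω → S) : Prop where
  measurable : ∀ (t : ℕ) (x : S), MeasurableSet {ω | s t ω = x}
  markov : ∀ (t : ℕ) (x : ℕ → S),
    ℙ.real {ω | ∀ i ≤ t + 1, s i ω = x i} =
      ℙ.real {ω | ∀ i ≤ t, s i ω = x i} * P (x t) (x (t + 1))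

/-- The squared Dirichlet seminorm `½ ∑ μ(s) P(s' | s) (f(s) - f(s'))²`. -/
def dirSq {S : Type*} [Fintype S] (P : Matrix S S ℝ) (μ : S → ℝ) (f : S → ℝ) : ℝ :=
  (1 / 2) * ∑ s, ∑ s', μ s * P s s' * (f s - f s') ^ 2

/-- The Euclidean projection onto the closed ball of radius `ρ` (for `0 ≤ ρ`). -/
def projBall {E : Type*} [NormedAddCommGroup E] [NormedSpace ℝ E] (ρ : ℝ) (x : E) : E :=
  open Classical in if ‖x‖ ≤ ρ then x else (ρ / ‖x‖) • x

namespace Model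

variable {S A : Type*} [Fintype S] [Fintype A] {d : ℕ}

/-- The transition matrix induced by the policy. -/
def P (m : Model S A d) : Matrix S S ℝ := fun s s' => ∑ a, m.env s a s' * m.policy s a

/-- The vector of expected rewards, `r_s = ∑ₐ π(a | s) r(s, a)`. -/
def R (m : Model S A d) : S → ℝ := fun s => ∑ a, m.policy s a * m.reward s a

/-- `r_max = max |r(s, a)|`. -/
def rMax (m : Model S A d) : ℝ := ⨆ p : S × A, |m.reward p.1 p.2|

/-- The feature vector `φ(s)`, the `s`-th row of `Φ`, in Euclidean space. -/
def φ (m : Model S A d) (s : S) : EuclideanSpace ℝ (Fin d) := WithLp.toLp 2 (m.Φ s)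

/-- The function `Φ θ` on states, `(Φ θ)(s) = φ(s)ᵀ θ`. -/
def lin (m : Model S A d) (θ : EuclideanSpace ℝ (Fin d)) : S → ℝ := m.Φ *ᵥ θ.ofLp

/-- Normalized features, `‖φ(s)‖ ≤ 1`, and linearly independent columns of `Φ`. -/
structure GoodFeatures (m : Model S A d) : Prop where
  norm_le_one : ∀ s, ‖m.φ s‖ ≤ 1
  linearIndependent : LinearIndependent ℝ m.Φ.col

/-- The condition number `η = min_{‖x‖ = 1} ‖Φ x‖²_Dir + (μᵀ Φ x)²`. -/
def eta (m : Model S A d) (μ : S → ℝ) : ℝ :=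
  ⨅ x : Metric.sphere (0 : EuclideanSpace ℝ (Fin d)) 1,
    (dirSq m.P μ (m.lin x) + (μ ⬝ᵥ m.lin x) ^ 2)

/-- `η' = λ_min(Φᵀ D Φ) = min_{‖x‖ = 1} ‖Φ x‖²_D`. -/
def eta' (m : Model S A d) (μ : S → ℝ) : ℝ :=
  ⨅ x : Metric.sphere (0 : EuclideanSpace ℝ (Fin d)) 1, ∑ s, μ s * m.lin x s ^ 2

/-- `w* = Φᵀ μ`. -/
def wStar (m : Model S A d) (μ : S → ℝ) : EuclideanSpace ℝ (Fin d) :=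
  WithLp.toLp 2 (m.Φᵀ *ᵥ μ)

/-- The stationary mean `Φᵀ D (R + P Φ θ - Φ θ) - μᵀ (R + Φ θ) w` of the `θ`-update. -/
def gBar [DecidableEq S] (m : Model S A d) (μ : S → ℝ) (w θ : EuclideanSpace ℝ (Fin d)) :
    EuclideanSpace ℝ (Fin d) :=
  WithLp.toLp 2 (m.Φᵀ *ᵥ (Matrix.diagonal μ *ᵥ (m.R + m.P *ᵥ m.lin θ - m.lin θ)))
    - (μ ⬝ᵥ (m.R + m.lin θ)) • w

/-- The defining equation of `θ*`: the mean `θ`-update vanishes at `(w*, θ*)`. -/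
def IsFixedPoint [DecidableEq S] (m : Model S A d) (μ : S → ℝ)
    (θ : EuclideanSpace ℝ (Fin d)) : Prop :=
  m.gBar μ (m.wStar μ) θ = 0

/-- `f(s, w) = φ(s) - w`. -/
def fUpd (m : Model S A d) (s : S) (w : EuclideanSpace ℝ (Fin d)) :
    EuclideanSpace ℝ (Fin d) :=
  m.φ s - w

/-- `g(s, s', w, θ) = (r_s + φ(s')ᵀθ - φ(s)ᵀθ) φ(s) - (r_s + φ(s)ᵀθ) w`. -/
def gUpd (m : Model S A d) (s s' : S) (w θ : EuclideanSpace ℝ (Fin d)) :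
    EuclideanSpace ℝ (Fin d) :=
  (m.R s + m.lin θ s' - m.lin θ s) • m.φ s - (m.R s + m.lin θ s) • w

/-- One step of the single-chain algorithm from `p = (w, θ)`, with step size `α` for `θ` and `β`
for `w`, projection radii `Rw`, `Rθ`, current state `s` and next state `s'`. -/
def next (m : Model S A d) (α β Rw Rθ : ℝ) (s s' : S)
    (p : EuclideanSpace ℝ (Fin d) × EuclideanSpace ℝ (Fin d)) :
    EuclideanSpace ℝ (Fin d) × EuclideanSpace ℝ (Fin d) :=
  (projBall Rw (p.1 + β • m.fUpd s p.1), projBall Rθ (p.2 + α • m.gUpd s s' p.1 p.2))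

/-- The iterates `(w_t, θ_t)` of the single-chain algorithm along the trajectory `s`, with step
sizes `α`, `β`, projection radii `Rw`, `Rθ` and initial point `(w₀, θ₀)`. Under Markov sampling
the state `s_t'` that follows `s_t` is the next state `s_{t+1}` of the chain. -/
def iterates (m : Model S A d) (α β : ℕ → ℝ) (Rw Rθ : ℝ)
    (w₀ θ₀ : EuclideanSpace ℝ (Fin d)) (s : ℕ → S) :
    ℕ → EuclideanSpace ℝ (Fin d) × EuclideanSpace ℝ (Fin d)
  | 0 => (w₀, θ₀)
  | t + 1 => m.next (α t) (β t) Rw Rθ (s t) (s (t + 1)) (iterates m α β Rw Rθ w₀ θ₀ s t)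

end Model

/-- The step size `α_t = a / (t + c₀)^ξ`. -/
def step (a c₀ ξ : ℝ) (t : ℕ) : ℝ := a / ((t : ℝ) + c₀) ^ ξ

/-- `L₁ = max {1, (log C + 1) / log (1/b)}` for the mixing bound `C bᵏ`
(for `b = 0` this is `1`). -/
def L₁ (C b : ℝ) : ℝ := max 1 ((Real.log C + 1) / Real.log (1 / b))

/-- `c_{1,λ} = η - λ² (r_max + 2 R_θ) / 2`. -/
def c₁ (η rmax Rθ lam : ℝ) : ℝ := η - lam ^ 2 * (rmax + 2 * Rθ) / 2

/-- `c_{2,λ} = (r_max + 2 R_θ) / λ²`. -/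
def c₂ (rmax Rθ lam : ℝ) : ℝ := (rmax + 2 * Rθ) / lam ^ 2

/-- `G₁(T) = (4 ρ₁ L₁ (log (T + c₀) - log a + 1) + 4) (r_max + 3 R_θ)²`, `ρ₁ = 28 + 8 ρ₀`. -/
def G₁ (a c₀ ρ₀ C b rmax Rθ : ℝ) (T : ℕ) : ℝ :=
  (4 * (28 + 8 * ρ₀) * L₁ C b * (Real.log ((T : ℝ) + c₀) - Real.log a + 1) + 4)
    * (rmax + 3 * Rθ) ^ 2

/-- `G₂(T) = 64 L₁ (log (T + c₀) - log (ρ₀ a) + 1) + 12`. -/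
def G₂ (a c₀ ρ₀ C b : ℝ) (T : ℕ) : ℝ :=
  64 * L₁ C b * (Real.log ((T : ℝ) + c₀) - Real.log (ρ₀ * a) + 1) + 12

/-- `Γ₀ = 4 a² / (1 - a c_{1,λ})`. -/
def Γ₀ (a c1 : ℝ) : ℝ := 4 * a ^ 2 / (1 - a * c1)

open Classical in
/-- `Γ₁`, in the three regimes `ρ₀ a < 1/2`, `ρ₀ a = 1/2` and `ρ₀ a > 1/2`. Here `c1`, `c2` are
`c_{1,λ}`, `c_{2,λ}`, `G2` is `G₂(T)`, and `τ` is the mixing time. -/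
def Γ₁ (a c₀ ρ₀ c1 c2 G2 : ℝ) (τ T : ℕ) : ℝ :=
  if ρ₀ * a < 1 / 2 then
    (2 : ℝ) ^ (a * c1) * a * c2 / (2 * ρ₀ * a - a * c1) *
      (4 * ((τ : ℝ) + c₀) ^ (2 * ρ₀ * a) + 4 * ρ₀ ^ 2 * a ^ 2 / (1 - 2 * ρ₀ * a) * G2)
  else if ρ₀ * a = 1 / 2 then
    4 * a * c2 / (1 - a * c1) *
      (4 * ((τ : ℝ) + c₀) ^ (2 * ρ₀ * a)
        + 4 * ρ₀ ^ 2 * a ^ 2 * Real.log ((T : ℝ) + c₀) * G2)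
  else
    4 * a * c2 / (1 - a * c1) *
      (4 * ((τ : ℝ) + c₀) ^ (2 * ρ₀ * a)
        + 4 * Real.exp 1 * ρ₀ ^ 2 * a ^ 2 / (2 * ρ₀ * a - 1) * G2)

/-- `Δ_T = (T + c₀)^{1-ξ} - (τ + c₀)^{1-ξ}`. -/
def Δ (c₀ ξ : ℝ) (τ T : ℕ) : ℝ :=
  ((T : ℝ) + c₀) ^ (1 - ξ) - ((τ : ℝ) + c₀) ^ (1 - ξ)

end SingleChainTD

end

open SingleChainTD

/-! This is two-timescale stochastic approximation with Markovian noise. At `w = w*` the mean update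
contracts: writing `x = θ - θ*`, stationarity gives `⟨gBar, x⟩ = -(‖Φx‖²_Dir + (μᵀΦx)²) ≤ -η‖x‖²`
(`dirSq_eq`, `inner_gBar_sub`, `inner_gBar_le`). Replacing `w*` by the running `w` costs a term
bilinear in the two errors; Young's inequality with weight `λ²` splits it, which lowers the rate `η`
to `c₁` and charges `c₂` to the `w`-error. The noise is correlated with the iterates, so it is
evaluated at the iterates of `k` steps earlier, with `k` the mixing time at the precision of the
current step size. Over that lag the iterates move by `O(k α)`, and the noise at the old iterates
has mean `O(α)` because the chain has mixed (`integral_transition_le`). As `k` is logarithmic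
(`mixingTime_le`), the total error is `α²` times a logarithm. Taking expectations leaves two scalar
recursions (`errorRecursion`): `Y` for the `w`-error, contracting at rate `2ρ₀α`, and `X` for the
`θ`-error, contracting at rate `2c₁α` and driven by `Y`. For `ξ < 1` they are solved by an explicit
supersolution in terms of the accumulated step size (`le_of_twoTimescale`). For `ξ = 1`
multiplication by `(t + c₀)^p` makes the forcing telescope (`rpow_mul_le_of_recursion`), with three
regimes for the decay of `Y`. The condition-number bound is arithmetic with the chosen `λ`
(`leadingCoeff_le`). -/

namespace SingleChainTD

/-! ### Euclidean projection onto a ball. -/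

section Projection

variable {E : Type*} [NormedAddCommGroup E] [InnerProductSpace ℝ E]

lemma projBall_of_norm_le {ρ : ℝ} {x : E} (h : ‖x‖ ≤ ρ) : projBall ρ x = x := by
  simp [projBall, h]

lemma norm_projBall_le {ρ : ℝ} (hρ : 0 ≤ ρ) (x : E) : ‖projBall ρ x‖ ≤ ρ := by
  unfold projBall
  split_ifs with h
  · exact h
  · have hx : 0 < ‖x‖ := lt_of_le_of_lt hρ (not_le.mp h)
    rw [norm_smul, Real.norm_of_nonneg (by positivity), div_mul_cancel₀ _ hx.ne']

/-- Projecting onto the ball does not increase the distance to a point of the ball. -/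
lemma norm_projBall_sub_le {ρ : ℝ} (hρ : 0 ≤ ρ) (x : E) {y : E} (hy : ‖y‖ ≤ ρ) :
    ‖projBall ρ x - y‖ ≤ ‖x - y‖ := by
  unfold projBall
  split_ifs with h
  · exact le_rfl
  · have hx : 0 < ‖x‖ := lt_of_le_of_lt hρ (not_le.mp h)
    set c := ρ / ‖x‖ with hc
    have hρc : ρ = c * ‖x‖ := by rw [hc, div_mul_cancel₀ _ hx.ne']
    have hc1 : c ≤ 1 := by rw [hc, div_le_one hx]; exact (not_le.mp h).le
    have hin : inner ℝ x y ≤ ‖x‖ * (c * ‖x‖) := by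
      rw [← hρc]
      exact (real_inner_le_norm x y).trans (by gcongr)
    rw [← sq_le_sq₀ (norm_nonneg _) (norm_nonneg _), norm_sub_sq_real, norm_sub_sq_real,
      norm_smul, inner_smul_left, Real.norm_of_nonneg (by positivity)]
    simp only [conj_trivial]
    -- The gap `‖x - y‖² - ‖c x - y‖²` equals `(1 - c)²‖x‖² + 2(1 - c)(c‖x‖² - ⟨x, y⟩)`.
    nlinarith [mul_nonneg (sub_nonneg.2 hc1) (sub_nonneg.2 hin), sq_nonneg ((1 - c) * ‖x‖)]

end Projection

/-! ### Stationary averages, the mean update and the condition numbers. -/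

namespace IsStationaryDist

variable {S : Type*} [Fintype S] {P : Matrix S S ℝ} {μ : S → ℝ}

lemma sum_sum_mul_next (h : IsStationaryDist P μ) (f : S → ℝ) :
    ∑ s, ∑ s', μ s * P s s' * f s' = ∑ s, μ s * f s := by
  rw [Finset.sum_comm]
  refine Finset.sum_congr rfl fun s' _ => ?_
  rw [← Finset.sum_mul]
  congr 1
  exact congrFun h.invariant s'

end IsStationaryDist

namespace Model

variable {S A : Type*} [Fintype S] [Fintype A] {d : ℕ} (m : Model S A d)

lemma P_nonneg (s s' : S) : 0 ≤ m.P s s' :=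
  Finset.sum_nonneg fun a _ => mul_nonneg (m.env_nonneg s a s') (m.policy_nonneg s a)

lemma sum_P (s : S) : ∑ s', m.P s s' = 1 := by
  unfold P
  rw [Finset.sum_comm]
  simp_rw [← Finset.sum_mul, m.env_sum, one_mul, m.policy_sum]

lemma rMax_nonneg : 0 ≤ m.rMax := Real.iSup_nonneg fun _ => abs_nonneg _

lemma abs_reward_le (s : S) (a : A) : |m.reward s a| ≤ m.rMax :=
  le_ciSup (f := fun p : S × A => |m.reward p.1 p.2|) (Set.finite_range _).bddAbove (s, a)

lemma abs_R_le (s : S) : |m.R s| ≤ m.rMax := by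
  calc |m.R s| ≤ ∑ a, |m.policy s a * m.reward s a| := Finset.abs_sum_le_sum_abs _ _
    _ ≤ ∑ a, m.policy s a * m.rMax := by
        refine Finset.sum_le_sum fun a _ => ?_
        rw [abs_mul, abs_of_nonneg (m.policy_nonneg s a)]
        exact mul_le_mul_of_nonneg_left (m.abs_reward_le s a) (m.policy_nonneg s a)
    _ = m.rMax := by rw [← Finset.sum_mul, m.policy_sum, one_mul]

lemma inner_φ (s : S) (x : EuclideanSpace ℝ (Fin d)) : inner ℝ (m.φ s) x = m.lin x s := by
  simp [φ, lin, PiLp.inner_apply, Matrix.mulVec, dotProduct, mul_comm]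

lemma lin_sub (x y : EuclideanSpace ℝ (Fin d)) (s : S) :
    m.lin (x - y) s = m.lin x s - m.lin y s := by
  simp_rw [← inner_φ, inner_sub_right]

lemma lin_smul (c : ℝ) (x : EuclideanSpace ℝ (Fin d)) (s : S) :
    m.lin (c • x) s = c * m.lin x s := by
  simp_rw [← inner_φ, inner_smul_right]

variable {m} in
lemma GoodFeatures.abs_lin_le (h : m.GoodFeatures) (x : EuclideanSpace ℝ (Fin d)) (s : S) :
    |m.lin x s| ≤ ‖x‖ := by
  rw [← inner_φ]
  calc |inner ℝ (m.φ s) x| ≤ ‖m.φ s‖ * ‖x‖ := abs_real_inner_le_norm _ _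
    _ ≤ 1 * ‖x‖ := by gcongr; exact h.norm_le_one s
    _ = ‖x‖ := one_mul _

lemma wStar_eq (μ : S → ℝ) : m.wStar μ = ∑ s, μ s • m.φ s := by
  ext i
  simp [wStar, φ, Matrix.mulVec, dotProduct, mul_comm]

lemma inner_wStar (μ : S → ℝ) (x : EuclideanSpace ℝ (Fin d)) :
    inner ℝ (m.wStar μ) x = μ ⬝ᵥ m.lin x := by
  rw [wStar_eq, sum_inner]
  simp_rw [inner_smul_left, inner_φ]
  rfl

lemma sum_mul_P (c : ℝ) (s : S) : ∑ s', c * m.P s s' = c := by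
  rw [← Finset.mul_sum, m.sum_P, mul_one]

lemma sum_sum_mul_left (μ f : S → ℝ) :
    ∑ s, ∑ s', μ s * m.P s s' * f s = ∑ s, μ s * f s := by
  simp_rw [← Finset.sum_mul, sum_mul_P]

lemma inner_gUpd (s s' : S) (w θ x : EuclideanSpace ℝ (Fin d)) :
    inner ℝ (m.gUpd s s' w θ) x
      = (m.R s + m.lin θ s' - m.lin θ s) * m.lin x s - (m.R s + m.lin θ s) * inner ℝ w x := by
  rw [gUpd, inner_sub_left, inner_smul_left, inner_smul_left, inner_φ]
  rfl

/-- The mean update is the average of the updates over stationary transitions. -/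
lemma gBar_eq_sum [DecidableEq S] (μ : S → ℝ) (w θ : EuclideanSpace ℝ (Fin d)) :
    m.gBar μ w θ = ∑ s, ∑ s', (μ s * m.P s s') • m.gUpd s s' w θ := by
  ext i
  have e : ∀ s s', ((μ s * m.P s s') • m.gUpd s s' w θ) i
      = μ s * m.P s s' * ((m.R s - m.lin θ s) * m.Φ s i)
        + m.Φ s i * (μ s * (m.P s s' * m.lin θ s'))
        - μ s * m.P s s' * (m.R s + m.lin θ s) * w i := by
    intro s s'
    simp [gUpd, φ]
    ring
  simp only [WithLp.ofLp_sum, Finset.sum_apply, e]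
  simp only [Finset.sum_add_distrib, Finset.sum_sub_distrib, ← Finset.sum_mul,
    sum_mul_P]
  rw [← Finset.sum_add_distrib]
  simp only [gBar, PiLp.sub_apply, PiLp.smul_apply, smul_eq_mul]
  congr 1
  simp only [Matrix.mulVec, dotProduct, Matrix.transpose_apply, Matrix.diagonal_apply,
    ite_mul, zero_mul, Finset.sum_ite_eq, Finset.mem_univ, if_true, Pi.add_apply, Pi.sub_apply]
  refine Finset.sum_congr rfl fun s _ => ?_
  rw [← Finset.mul_sum, ← Finset.mul_sum]
  ring

section Stationary

variable {m} {μ : S → ℝ} (hμ : IsStationaryDist m.P μ) (hf : m.GoodFeatures)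

include hμ

lemma sum_sum_mul_P : ∑ s, ∑ s', μ s * m.P s s' = 1 := by
  simp_rw [← Finset.mul_sum, m.sum_P, mul_one]
  exact hμ.sum_eq_one

include hf in
lemma norm_wStar_le : ‖m.wStar μ‖ ≤ 1 := by
  rw [wStar_eq]
  calc ‖∑ s, μ s • m.φ s‖ ≤ ∑ s, ‖μ s • m.φ s‖ := norm_sum_le _ _
    _ ≤ ∑ s, μ s * 1 := by
        refine Finset.sum_le_sum fun s _ => ?_
        rw [norm_smul, Real.norm_of_nonneg (hμ.nonneg s)]
        exact mul_le_mul_of_nonneg_left (hf.norm_le_one s) (hμ.nonneg s)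
    _ = 1 := by simp [hμ.sum_eq_one]

/-- Under a stationary transition `f(s)²` and `f(s')²` have the same mean, so expanding the square
leaves only the cross term. Reversibility is not needed. -/
lemma dirSq_eq (f : S → ℝ) :
    ∑ s, ∑ s', μ s * m.P s s' * ((f s' - f s) * f s) = -dirSq m.P μ f := by
  have h1 := m.sum_sum_mul_left μ (fun s => f s ^ 2)
  have h2 := hμ.sum_sum_mul_next (fun s => f s ^ 2)
  have e : ∀ s s', μ s * m.P s s' * (f s - f s') ^ 2
      = μ s * m.P s s' * f s' ^ 2 - μ s * m.P s s' * f s ^ 2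
        - 2 * (μ s * m.P s s' * ((f s' - f s) * f s)) := by intro s s'; ring
  unfold dirSq
  simp only [e, Finset.sum_sub_distrib, ← Finset.mul_sum]
  rw [h1, h2]
  ring

/-- The rewards cancel because `gBar` is affine in `θ`. At `w = w*` the last factor is `μᵀΦx` too,
so the right side becomes minus the quadratic form that defines `η`. -/
lemma inner_gBar_sub [DecidableEq S] (w θ θ' : EuclideanSpace ℝ (Fin d)) :
    inner ℝ (m.gBar μ w θ - m.gBar μ w θ') (θ - θ')
      = -dirSq m.P μ (m.lin (θ - θ')) - (μ ⬝ᵥ m.lin (θ - θ')) * inner ℝ w (θ - θ') := by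
  set x := θ - θ' with hx
  rw [gBar_eq_sum, gBar_eq_sum, ← Finset.sum_sub_distrib, sum_inner,
    ← dirSq_eq hμ]
  simp_rw [← Finset.sum_sub_distrib, sum_inner, inner_sub_left, inner_smul_left,
    m.inner_gUpd, conj_trivial]
  have e : ∀ s s', μ s * m.P s s' * ((m.R s + m.lin θ s' - m.lin θ s) * m.lin x s
        - (m.R s + m.lin θ s) * inner ℝ w x)
      - μ s * m.P s s' * ((m.R s + m.lin θ' s' - m.lin θ' s) * m.lin x s
        - (m.R s + m.lin θ' s) * inner ℝ w x)
      = μ s * m.P s s' * ((m.lin x s' - m.lin x s) * m.lin x s)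
        - μ s * m.P s s' * m.lin x s * inner ℝ w x := by
    intro s s'
    have e1 : m.lin θ s = m.lin θ' s + m.lin x s := by rw [hx, lin_sub]; ring
    have e2 : m.lin θ s' = m.lin θ' s' + m.lin x s' := by rw [hx, lin_sub]; ring
    rw [e1, e2]; ring
  simp_rw [e, Finset.sum_sub_distrib, ← Finset.sum_mul, sum_mul_P]
  rfl

lemma dirSq_nonneg (f : S → ℝ) : 0 ≤ dirSq m.P μ f := by
  unfold dirSq
  have := Finset.sum_nonneg fun s (_ : s ∈ Finset.univ) =>
    Finset.sum_nonneg fun s' (_ : s' ∈ Finset.univ) =>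
      mul_nonneg (mul_nonneg (hμ.nonneg s) (m.P_nonneg s s')) (sq_nonneg (f s - f s'))
  linarith

lemma eta_nonneg : 0 ≤ m.eta μ :=
  Real.iInf_nonneg fun _ => add_nonneg (dirSq_nonneg hμ _) (sq_nonneg _)

lemma eta'_nonneg : 0 ≤ m.eta' μ :=
  Real.iInf_nonneg fun _ =>
    Finset.sum_nonneg fun s _ => mul_nonneg (hμ.nonneg s) (sq_nonneg _)

lemma eta_le_of_norm_eq_one (x : EuclideanSpace ℝ (Fin d)) (hx : ‖x‖ = 1) :
    m.eta μ ≤ dirSq m.P μ (m.lin x) + (μ ⬝ᵥ m.lin x) ^ 2 := by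
  refine ciInf_le (f := fun x : Metric.sphere (0 : EuclideanSpace ℝ (Fin d)) 1 =>
    dirSq m.P μ (m.lin x) + (μ ⬝ᵥ m.lin x) ^ 2) ⟨0, ?_⟩ ⟨x, by simpa using hx⟩
  rintro _ ⟨y, rfl⟩
  exact add_nonneg (dirSq_nonneg hμ _) (sq_nonneg _)

/-- Both terms are homogeneous of degree two, which carries the bound from the unit sphere to all
vectors. -/
lemma eta_mul_norm_sq_le (x : EuclideanSpace ℝ (Fin d)) :
    m.eta μ * ‖x‖ ^ 2 ≤ dirSq m.P μ (m.lin x) + (μ ⬝ᵥ m.lin x) ^ 2 := by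
  rcases eq_or_ne x 0 with rfl | hx
  · simpa using add_nonneg (dirSq_nonneg hμ _) (sq_nonneg _)
  have hx' : 0 < ‖x‖ := norm_pos_iff.2 hx
  have h := eta_le_of_norm_eq_one hμ (‖x‖⁻¹ • x) (by
    rw [norm_smul, norm_inv, norm_norm, inv_mul_cancel₀ hx'.ne'])
  have e : m.lin (‖x‖⁻¹ • x) = ‖x‖⁻¹ • m.lin x := by
    ext s; simp [lin_smul]
  have e2 : dirSq m.P μ (‖x‖⁻¹ • m.lin x) = ‖x‖⁻¹ ^ 2 * dirSq m.P μ (m.lin x) := by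
    unfold dirSq
    simp only [Finset.mul_sum, Pi.smul_apply, smul_eq_mul]
    refine Finset.sum_congr rfl fun s _ => Finset.sum_congr rfl fun s' _ => ?_
    ring
  rw [e, e2, dotProduct_smul, smul_eq_mul, mul_pow, ← mul_add] at h
  calc m.eta μ * ‖x‖ ^ 2
      ≤ ‖x‖⁻¹ ^ 2 * (dirSq m.P μ (m.lin x) + (μ ⬝ᵥ m.lin x) ^ 2) * ‖x‖ ^ 2 := by gcongr
    _ = _ := by field_simp

include hf

lemma abs_dotProduct_lin_le (x : EuclideanSpace ℝ (Fin d)) : |μ ⬝ᵥ m.lin x| ≤ ‖x‖ := by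
  rw [← inner_wStar]
  calc |inner ℝ (m.wStar μ) x| ≤ ‖m.wStar μ‖ * ‖x‖ := abs_real_inner_le_norm _ _
    _ ≤ 1 * ‖x‖ := by gcongr; exact norm_wStar_le hμ hf
    _ = ‖x‖ := one_mul _

/-- Test on a basis vector: the Dirichlet part is at most 2 and the squared mean at most 1. For `d =
0` the sphere is empty and the real infimum is 0. Together with `α ≤ 1/6` this keeps the factors `1
- 2αc₁` nonnegative. -/
lemma eta_le_three : m.eta μ ≤ 3 := by
  rcases Nat.eq_zero_or_pos d with rfl | hd
  · have : IsEmpty (Metric.sphere (0 : EuclideanSpace ℝ (Fin 0)) 1) := by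
      refine ⟨fun x => ?_⟩
      have := x.2
      rw [Subsingleton.elim (x : EuclideanSpace ℝ (Fin 0)) 0] at this
      simp at this
    rw [eta, Real.iInf_of_isEmpty]; norm_num
  · let x : EuclideanSpace ℝ (Fin d) := EuclideanSpace.single ⟨0, hd⟩ 1
    have hx : ‖x‖ = 1 := by simp [x]
    refine (eta_le_of_norm_eq_one hμ x hx).trans ?_
    have h1 : (μ ⬝ᵥ m.lin x) ^ 2 ≤ 1 := by
      rw [sq_le_one_iff_abs_le_one, ← hx]; exact abs_dotProduct_lin_le hμ hf x
    have h2 : dirSq m.P μ (m.lin x) ≤ 2 := by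
      have : ∑ s, ∑ s', μ s * m.P s s' * (m.lin x s - m.lin x s') ^ 2
          ≤ ∑ s, ∑ s', μ s * m.P s s' * 4 := by
        refine Finset.sum_le_sum fun s _ => Finset.sum_le_sum fun s' _ => ?_
        have a1 := abs_le.1 (hf.abs_lin_le x s)
        have a2 := abs_le.1 (hf.abs_lin_le x s')
        rw [hx] at a1 a2
        refine mul_le_mul_of_nonneg_left ?_ (mul_nonneg (hμ.nonneg s) (m.P_nonneg s s'))
        nlinarith
      simp_rw [← Finset.sum_mul] at this
      rw [sum_sum_mul_P hμ] at this
      unfold dirSq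
      linarith
    linarith

lemma eta'_le_one : m.eta' μ ≤ 1 := by
  rcases Nat.eq_zero_or_pos d with rfl | hd
  · have : IsEmpty (Metric.sphere (0 : EuclideanSpace ℝ (Fin 0)) 1) := by
      refine ⟨fun x => ?_⟩
      have := x.2
      rw [Subsingleton.elim (x : EuclideanSpace ℝ (Fin 0)) 0] at this
      simp at this
    rw [eta', Real.iInf_of_isEmpty]; norm_num
  · let x : EuclideanSpace ℝ (Fin d) := EuclideanSpace.single ⟨0, hd⟩ 1
    have hx : ‖x‖ = 1 := by simp [x]
    refine (ciInf_le (f := fun x : Metric.sphere (0 : EuclideanSpace ℝ (Fin d)) 1 =>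
      ∑ s, μ s * m.lin x s ^ 2) ⟨0, ?_⟩ ⟨x, by simpa using hx⟩).trans ?_
    · rintro _ ⟨y, rfl⟩
      exact Finset.sum_nonneg fun s _ => mul_nonneg (hμ.nonneg s) (sq_nonneg _)
    · calc ∑ s, μ s * m.lin x s ^ 2 ≤ ∑ s, μ s * 1 := by
            refine Finset.sum_le_sum fun s _ => mul_le_mul_of_nonneg_left ?_ (hμ.nonneg s)
            rw [sq_le_one_iff_abs_le_one, ← hx]; exact hf.abs_lin_le x s
        _ = 1 := by simp [hμ.sum_eq_one]

end Stationary

/-! ### Size, Lipschitz and drift bounds for the updates. -/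

section Bounds

variable {m} {μ : S → ℝ} (hμ : IsStationaryDist m.P μ) (hf : m.GoodFeatures)

include hμ in
lemma norm_sum_sum_smul_le {E : Type*} [NormedAddCommGroup E] [NormedSpace ℝ E]
    (v : S → S → E) {B : ℝ} (h : ∀ s s', ‖v s s'‖ ≤ B) :
    ‖∑ s, ∑ s', (μ s * m.P s s') • v s s'‖ ≤ B := by
  calc ‖∑ s, ∑ s', (μ s * m.P s s') • v s s'‖
      ≤ ∑ s, ∑ s', ‖(μ s * m.P s s') • v s s'‖ :=
        (norm_sum_le _ _).trans (Finset.sum_le_sum fun s _ => norm_sum_le _ _)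
    _ ≤ ∑ s, ∑ s', μ s * m.P s s' * B := by
        refine Finset.sum_le_sum fun s _ => Finset.sum_le_sum fun s' _ => ?_
        have h0 := mul_nonneg (hμ.nonneg s) (m.P_nonneg s s')
        rw [norm_smul, Real.norm_of_nonneg h0]
        exact mul_le_mul_of_nonneg_left (h s s') h0
    _ = B := by simp_rw [← Finset.sum_mul]; rw [sum_sum_mul_P hμ, one_mul]

include hf

lemma norm_gUpd_le (s s' : S) {w θ : EuclideanSpace ℝ (Fin d)} {r : ℝ} (hw : ‖w‖ ≤ 1)
    (hθ : ‖θ‖ ≤ r) : ‖m.gUpd s s' w θ‖ ≤ 2 * m.rMax + 3 * r := by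
  have h1 := abs_le.1 (m.abs_R_le s)
  have h2 := abs_le.1 (hf.abs_lin_le θ s)
  have h3 := abs_le.1 (hf.abs_lin_le θ s')
  have h0 := norm_nonneg θ
  have h4 : ‖(m.R s + m.lin θ s' - m.lin θ s) • m.φ s‖ ≤ m.rMax + 2 * r := by
    rw [norm_smul, Real.norm_eq_abs, ← mul_one (m.rMax + 2 * r)]
    refine mul_le_mul (abs_le.2 ⟨?_, ?_⟩) (hf.norm_le_one s) (norm_nonneg _) ?_ <;> linarith
  have h5 : ‖(m.R s + m.lin θ s) • w‖ ≤ m.rMax + r := by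
    rw [norm_smul, Real.norm_eq_abs, ← mul_one (m.rMax + r)]
    refine mul_le_mul (abs_le.2 ⟨?_, ?_⟩) hw (norm_nonneg _) ?_ <;> linarith
  calc ‖m.gUpd s s' w θ‖ ≤ _ := norm_sub_le _ _
    _ ≤ _ := by linarith

lemma norm_gUpd_sub_le (s s' : S) {w w' θ θ' : EuclideanSpace ℝ (Fin d)} {r : ℝ}
    (hw' : ‖w'‖ ≤ 1) (hθ : ‖θ‖ ≤ r) :
    ‖m.gUpd s s' w θ - m.gUpd s s' w' θ'‖ ≤ 3 * ‖θ - θ'‖ + (m.rMax + r) * ‖w - w'‖ := by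
  -- In this splitting `w'` multiplies the `θ`-difference and `θ` the `w`-difference, so only these
  -- two need a norm bound.
  have e : m.gUpd s s' w θ - m.gUpd s s' w' θ'
      = (m.lin (θ - θ') s' - m.lin (θ - θ') s) • m.φ s - m.lin (θ - θ') s • w'
        - (m.R s + m.lin θ s) • (w - w') := by
    simp only [gUpd, lin_sub]
    module
  have h1 := abs_le.1 (m.abs_R_le s)
  have h2 := abs_le.1 (hf.abs_lin_le (θ - θ') s)
  have h3 := abs_le.1 (hf.abs_lin_le (θ - θ') s')
  have h6 := abs_le.1 (hf.abs_lin_le θ s)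
  have h0 := norm_nonneg (θ - θ')
  have h00 := norm_nonneg θ
  have h4 : ‖(m.lin (θ - θ') s' - m.lin (θ - θ') s) • m.φ s‖ ≤ 2 * ‖θ - θ'‖ := by
    rw [norm_smul, Real.norm_eq_abs, ← mul_one (2 * ‖θ - θ'‖)]
    refine mul_le_mul (abs_le.2 ⟨?_, ?_⟩) (hf.norm_le_one s) (norm_nonneg _) ?_ <;> linarith
  have h5 : ‖m.lin (θ - θ') s • w'‖ ≤ ‖θ - θ'‖ := by
    rw [norm_smul, Real.norm_eq_abs, ← mul_one ‖θ - θ'‖]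
    exact mul_le_mul (abs_le.2 h2) hw' (norm_nonneg _) h0
  have h7 : ‖(m.R s + m.lin θ s) • (w - w')‖ ≤ (m.rMax + r) * ‖w - w'‖ := by
    rw [norm_smul, Real.norm_eq_abs]
    gcongr
    rw [abs_le]; constructor <;> linarith
  rw [e]
  refine (norm_sub_le _ _).trans ((add_le_add_left (norm_sub_le _ _) _).trans ?_)
  linarith

include hμ

lemma norm_gBar_le [DecidableEq S] {w θ : EuclideanSpace ℝ (Fin d)} {r : ℝ} (hw : ‖w‖ ≤ 1)
    (hθ : ‖θ‖ ≤ r) : ‖m.gBar μ w θ‖ ≤ 2 * m.rMax + 3 * r := by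
  rw [gBar_eq_sum]
  exact norm_sum_sum_smul_le hμ _ fun s s' => norm_gUpd_le hf s s' hw hθ

lemma norm_gBar_sub_le [DecidableEq S] {w w' θ θ' : EuclideanSpace ℝ (Fin d)} {r : ℝ}
    (hw' : ‖w'‖ ≤ 1) (hθ : ‖θ‖ ≤ r) :
    ‖m.gBar μ w θ - m.gBar μ w' θ'‖ ≤ 3 * ‖θ - θ'‖ + (m.rMax + r) * ‖w - w'‖ := by
  simp_rw [gBar_eq_sum, ← Finset.sum_sub_distrib, ← smul_sub]
  exact norm_sum_sum_smul_le hμ _ fun s s' => norm_gUpd_sub_le hf s s' hw' hθ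

/-- The mean drift towards the fixed point, up to the error of `w`. -/
lemma inner_gBar_le [DecidableEq S] {w θ θstar : EuclideanSpace ℝ (Fin d)} {r : ℝ}
    (hfix : m.IsFixedPoint μ θstar) (hθ : ‖θ‖ ≤ r) :
    inner ℝ (m.gBar μ w θ) (θ - θstar)
      ≤ -(m.eta μ * ‖θ - θstar‖ ^ 2)
        + (m.rMax + r) * (‖w - m.wStar μ‖ * ‖θ - θstar‖) := by
  have h1 := inner_gBar_sub hμ (m.wStar μ) θ θstar
  rw [show m.gBar μ (m.wStar μ) θstar = 0 from hfix, sub_zero, inner_wStar] at h1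
  have h2 := eta_mul_norm_sq_le hμ (θ - θstar)
  -- `gBar` is affine in `w`, with slope the stationary mean of `R + Φθ`, itself at most `rMax + r`.
  have e : m.gBar μ w θ = m.gBar μ (m.wStar μ) θ
      - (μ ⬝ᵥ (m.R + m.lin θ)) • (w - m.wStar μ) := by
    simp only [gBar]; module
  have h3 : |μ ⬝ᵥ (m.R + m.lin θ)| ≤ m.rMax + r := by
    calc |∑ s, μ s * (m.R s + m.lin θ s)| ≤ ∑ s, |μ s * (m.R s + m.lin θ s)| :=
          Finset.abs_sum_le_sum_abs _ _
      _ ≤ ∑ s, μ s * (m.rMax + r) := by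
          refine Finset.sum_le_sum fun s _ => ?_
          rw [abs_mul, abs_of_nonneg (hμ.nonneg s)]
          refine mul_le_mul_of_nonneg_left ((abs_add_le _ _).trans ?_) (hμ.nonneg s)
          exact add_le_add (m.abs_R_le s) ((hf.abs_lin_le θ s).trans hθ)
      _ = m.rMax + r := by rw [← Finset.sum_mul, hμ.sum_eq_one, one_mul]
  have h4 : -((μ ⬝ᵥ (m.R + m.lin θ)) * inner ℝ (w - m.wStar μ) (θ - θstar))
      ≤ (m.rMax + r) * (‖w - m.wStar μ‖ * ‖θ - θstar‖) := by
    refine (neg_le_abs _).trans ?_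
    rw [abs_mul]
    exact mul_le_mul h3 (abs_real_inner_le_norm _ _) (abs_nonneg _) ((abs_nonneg _).trans h3)
  rw [e, inner_sub_left, inner_smul_left, conj_trivial]
  nlinarith

end Bounds

end Model
-- Functionals of finitely many coordinates and the Markov property.
/-- The functional `f` of a path depends only on the coordinates up to time `n`. -/
def DependsUpTo {S E : Type*} (n : ℕ) (f : (ℕ → S) → E) : Prop :=
  ∀ x y : ℕ → S, (∀ i ≤ n, x i = y i) → f x = f y

lemma DependsUpTo.mono {S E : Type*} {n k : ℕ} {f : (ℕ → S) → E} (h : DependsUpTo n f)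
    (hk : n ≤ k) : DependsUpTo k f :=
  fun x y hxy => h x y fun i hi => hxy i (hi.trans hk)

namespace DependsUpTo

variable {S E F G : Type*} {n : ℕ}

lemma const (c : E) : DependsUpTo n fun _ : ℕ → S => c := fun _ _ _ => rfl

lemma coord {i : ℕ} (hi : i ≤ n) : DependsUpTo n fun x : ℕ → S => x i := fun _ _ h => h i hi

lemma map {f : (ℕ → S) → E} (hf : DependsUpTo n f) (φ : E → F) :
    DependsUpTo n fun x => φ (f x) := fun x y h => congrArg φ (hf x y h)

lemma map₂ {f : (ℕ → S) → E} {g : (ℕ → S) → F} (hf : DependsUpTo n f) (hg : DependsUpTo n g)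
    (φ : E → F → G) : DependsUpTo n fun x => φ (f x) (g x) :=
  fun x y h => congrArg₂ φ (hf x y h) (hg x y h)

lemma sum {ι : Type*} [AddCommMonoid E] (t : Finset ι) {f : ι → (ℕ → S) → E}
    (hf : ∀ i, DependsUpTo n (f i)) : DependsUpTo n fun x => ∑ i ∈ t, f i x :=
  fun x y h => Finset.sum_congr rfl fun i _ => hf i x y h

end DependsUpTo

/-- Extension of a path of length `n + 1` by its last state. -/
def extendPath {S : Type*} (n : ℕ) (x : Fin (n + 1) → S) : ℕ → S :=
  fun i => x ⟨min i n, Nat.lt_succ_of_le (min_le_right i n)⟩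

namespace IsMarkovChain

variable {S Ω : Type*} [Fintype S] [DecidableEq S] [MeasurableSpace Ω] {P : Matrix S S ℝ}
  {ℙ : Measure Ω} [IsProbabilityMeasure ℙ] {s : ℕ → Ω → S} (hs : IsMarkovChain P ℙ s)

omit [Fintype S] [DecidableEq S] [MeasurableSpace Ω] in
lemma path_eq_iff (n : ℕ) (ω : Ω) (x : Fin (n + 1) → S) :
    (∀ i ≤ n, s i ω = extendPath n x i) ↔ x = fun i : Fin (n + 1) => s i ω := by
  constructor
  · intro h
    ext i
    rw [h i (Nat.lt_succ_iff.1 i.2)]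
    congr 1
    exact Fin.ext (min_eq_left (Nat.lt_succ_iff.1 i.2)).symm
  · rintro rfl i hi
    simp [extendPath, min_eq_left hi]

-- As `S` is finite, such a functional is a finite combination of indicators of cylinder events.
-- Integrability and the Markov property thus reduce to finite sums, without conditional
-- expectations.
open Classical in
omit [MeasurableSpace Ω] in
lemma eq_sum_indicator {n : ℕ} {f : (ℕ → S) → ℝ} (hf : DependsUpTo n f) (ω : Ω) :
    f (fun t => s t ω) = ∑ x : Fin (n + 1) → S,
      {ω | ∀ i ≤ n, s i ω = extendPath n x i}.indicator (fun _ => f (extendPath n x)) ω := by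
  simp only [Set.indicator_apply, Set.mem_ofPred_eq, path_eq_iff]
  rw [Finset.sum_ite_eq']
  simpa using hf _ _ ((path_eq_iff n ω _).2 rfl)

include hs

omit [Fintype S] [DecidableEq S] [IsProbabilityMeasure ℙ] in
lemma measurableSet_path (n : ℕ) (x : ℕ → S) : MeasurableSet {ω | ∀ i ≤ n, s i ω = x i} := by
  have : {ω | ∀ i ≤ n, s i ω = x i} = ⋂ i ∈ Finset.Iic n, {ω | s i ω = x i} := by
    ext ω; simp
  rw [this]
  exact Finset.measurableSet_biInter _ fun i _ => hs.measurable i (x i)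

lemma integrable {n : ℕ} {f : (ℕ → S) → ℝ} (hf : DependsUpTo n f) :
    Integrable (fun ω => f (fun t => s t ω)) ℙ := by
  simp_rw [fun ω => eq_sum_indicator (s := s) hf ω]
  exact integrable_finsetSum _ fun x _ =>
    (integrable_const _).indicator (hs.measurableSet_path n _)

lemma integral_eq_sum {n : ℕ} {f : (ℕ → S) → ℝ} (hf : DependsUpTo n f) :
    ∫ ω, f (fun t => s t ω) ∂ℙ = ∑ x : Fin (n + 1) → S,
      ℙ.real {ω | ∀ i ≤ n, s i ω = extendPath n x i} * f (extendPath n x) := by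
  simp_rw [fun ω => eq_sum_indicator (s := s) hf ω]
  rw [integral_finsetSum _ fun x _ =>
    (integrable_const _).indicator (hs.measurableSet_path n _)]
  refine Finset.sum_congr rfl fun x _ => ?_
  rw [integral_indicator_const _ (hs.measurableSet_path n _), smul_eq_mul]

/-- The Markov property for functionals of the past. -/
lemma integral_mul_next {n : ℕ} {f : (ℕ → S) → ℝ} (hf : DependsUpTo n f) (h : S → ℝ) :
    ∫ ω, f (fun t => s t ω) * h (s (n + 1) ω) ∂ℙ
      = ∫ ω, f (fun t => s t ω) * (P *ᵥ h) (s n ω) ∂ℙ := by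
  have h1 : DependsUpTo n fun x : ℕ → S => f x * (P *ᵥ h) (x n) :=
    hf.map₂ (.coord le_rfl) fun u z => u * (P *ᵥ h) z
  have h2 : DependsUpTo (n + 1) fun x : ℕ → S => f x * h (x (n + 1)) :=
    (hf.mono n.le_succ).map₂ (.coord le_rfl) fun u z => u * h z
  -- A path of `n + 2` states is a path of `n + 1` states followed by a last one; summing over the
  -- last state produces `P *ᵥ h`.
  rw [hs.integral_eq_sum h1, hs.integral_eq_sum h2,
    ← (Fin.snocEquiv fun _ : Fin (n + 2) => S).sum_comp, Fintype.sum_prod_type, Finset.sum_comm]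
  refine Finset.sum_congr rfl fun x _ => ?_
  have e : ∀ y, ∀ i ≤ n, extendPath (n + 1) (Fin.snoc (α := fun _ => S) x y) i
      = extendPath n x i := by
    intro y i hi
    have hi' : min i (n + 1) < n + 1 := by omega
    simp only [extendPath, Fin.snoc, hi', dif_pos]
    rw [cast_eq]
    congr 1
    ext
    simp only [Fin.val_castLT]
    omega
  have e' : ∀ y, extendPath (n + 1) (Fin.snoc (α := fun _ => S) x y) (n + 1) = y := by
    intro y
    simp [extendPath, Fin.snoc]
  have key : ∀ y, ℙ.real {ω | ∀ i ≤ n + 1, s i ω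
        = extendPath (n + 1) (Fin.snoc (α := fun _ => S) x y) i}
      = ℙ.real {ω | ∀ i ≤ n, s i ω = extendPath n x i} * P (extendPath n x n) y := by
    intro y
    rw [hs.markov n, e', e y n le_rfl]
    congr 2
    ext ω
    exact forall₂_congr fun i hi => by rw [e y i hi]
  have key' : ∀ y, f (extendPath (n + 1) (Fin.snoc (α := fun _ => S) x y))
      = f (extendPath n x) := fun y => hf _ _ (e y)
  change ∑ y, ℙ.real {ω | ∀ i ≤ n + 1, s i ω
      = extendPath (n + 1) (Fin.snoc (α := fun _ => S) x y) i}
    * (f (extendPath (n + 1) (Fin.snoc (α := fun _ => S) x y))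
      * h (extendPath (n + 1) (Fin.snoc (α := fun _ => S) x y) (n + 1))) = _
  simp only [key, key', e', Matrix.mulVec, dotProduct, Finset.mul_sum]
  exact Finset.sum_congr rfl fun y _ => by ring

lemma integral_mul_add (k : ℕ) {n : ℕ} {f : (ℕ → S) → ℝ} (hf : DependsUpTo n f) (h : S → ℝ) :
    ∫ ω, f (fun t => s t ω) * h (s (n + k) ω) ∂ℙ
      = ∫ ω, f (fun t => s t ω) * (P ^ k *ᵥ h) (s n ω) ∂ℙ := by
  induction k generalizing h with
  | zero => simp
  | succ k ih =>
    rw [← add_assoc, hs.integral_mul_next (hf.mono (Nat.le_add_right n k)), ih,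
      Matrix.mulVec_mulVec, ← pow_succ]

/-- Conditional expectation of a function of the past up to time `n` and of the transition made
at time `n + k`. -/
lemma integral_transition (k : ℕ) {n : ℕ} {F : (ℕ → S) → S → S → ℝ}
    (hF : ∀ y y', DependsUpTo n fun x => F x y y') :
    ∫ ω, F (fun t => s t ω) (s (n + k) ω) (s (n + k + 1) ω) ∂ℙ
      = ∫ ω, ∑ y, ∑ y', (P ^ k) (s n ω) y * P y y' * F (fun t => s t ω) y y' ∂ℙ := by
  have e : ∀ ω, F (fun t => s t ω) (s (n + k) ω) (s (n + k + 1) ω) = ∑ y, ∑ y',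
      F (fun t => s t ω) y y' * (if s (n + k) ω = y then 1 else 0)
        * (if s (n + k + 1) ω = y' then 1 else 0) := by
    intro ω
    simp
  have d1 : ∀ y y', DependsUpTo (n + k) fun x : ℕ → S =>
      F x y y' * (if x (n + k) = y then 1 else 0) := fun y y' =>
    ((hF y y').mono (Nat.le_add_right n k)).map₂ (.coord le_rfl)
      fun u z => u * (if z = y then 1 else 0)
  have d2 : ∀ y y', DependsUpTo (n + k + 1) fun x : ℕ → S =>
      F x y y' * (if x (n + k) = y then 1 else 0)
        * (if x (n + k + 1) = y' then 1 else 0) := fun y y' =>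
    ((d1 y y').mono (n + k).le_succ).map₂ (.coord le_rfl)
      fun u z => u * (if z = y' then 1 else 0)
  have d3 : ∀ y y', DependsUpTo n fun x : ℕ → S =>
      (P ^ k) (x n) y * P y y' * F x y y' := fun y y' =>
    (hF y y').map₂ (.coord le_rfl) fun u z => (P ^ k) z y * P y y' * u
  simp_rw [e]
  rw [integral_finsetSum _ fun y _ => integrable_finsetSum _ fun y' _ => hs.integrable (d2 y y'),
    integral_finsetSum _ fun y _ => integrable_finsetSum _ fun y' _ => hs.integrable (d3 y y')]
  refine Finset.sum_congr rfl fun y _ => ?_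
  rw [integral_finsetSum _ fun y' _ => hs.integrable (d2 y y'),
    integral_finsetSum _ fun y' _ => hs.integrable (d3 y y')]
  refine Finset.sum_congr rfl fun y' _ => ?_
  -- The final transition is averaged out first, then the `k` steps before it.
  have h1 := hs.integral_mul_next (d1 y y') (fun z => if z = y' then 1 else 0)
  have h2 := hs.integral_mul_add k (hF y y')
    (fun z => (if z = y then 1 else 0) * (P *ᵥ fun z => if z = y' then 1 else 0) z)
  simp only at h1 h2
  rw [h1]
  simp_rw [mul_assoc, h2]
  refine integral_congr_ae (Filter.Eventually.of_forall fun ω => ?_)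
  simp [Matrix.mulVec, dotProduct]
  ring

lemma integral_mono_of_le {n k : ℕ} {f g : (ℕ → S) → ℝ} (hf : DependsUpTo n f)
    (hg : DependsUpTo k g) (h : ∀ x, f x ≤ g x) :
    ∫ ω, f (fun t => s t ω) ∂ℙ ≤ ∫ ω, g (fun t => s t ω) ∂ℙ :=
  integral_mono (hs.integrable hf) (hs.integrable hg) fun _ => h _

/-- Bounded functions of the past and of a later transition that average to zero over stationary
transitions have small expectation once the chain has mixed. -/
lemma integral_transition_le {μ : S → ℝ} (hP : ∀ y y', 0 ≤ P y y') (hP1 : ∀ y, ∑ y', P y y' = 1)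
    {k n : ℕ} {ε B : ℝ} (hB : 0 ≤ B) (hmix : ∀ y, mixDist P μ k y ≤ ε)
    {F : (ℕ → S) → S → S → ℝ}
    (hF : ∀ y y', DependsUpTo n fun x => F x y y')
    (hF0 : ∀ x, ∑ y, ∑ y', μ y * P y y' * F x y y' = 0) (hFB : ∀ x y y', |F x y y'| ≤ B) :
    ∫ ω, F (fun t => s t ω) (s (n + k) ω) (s (n + k + 1) ω) ∂ℙ ≤ B * ε := by
  rw [hs.integral_transition k hF]
  have hpt : ∀ x : ℕ → S, ∑ y, ∑ y', (P ^ k) (x n) y * P y y' * F x y y' ≤ B * ε := by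
    intro x
    -- Since `F` averages to zero under stationary transitions, `μ` may be subtracted from `P ^ k`;
    -- then the `ℓ¹` distance appears.
    calc ∑ y, ∑ y', (P ^ k) (x n) y * P y y' * F x y y'
        = ∑ y, ∑ y', ((P ^ k) (x n) y - μ y) * P y y' * F x y y' := by
          simp_rw [sub_mul, Finset.sum_sub_distrib]
          rw [hF0, sub_zero]
      _ ≤ ∑ y, ∑ y', |(P ^ k) (x n) y - μ y| * P y y' * B := by
          refine Finset.sum_le_sum fun y _ => Finset.sum_le_sum fun y' _ => ?_
          refine (le_abs_self _).trans ?_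
          rw [abs_mul, abs_mul, abs_of_nonneg (hP y y')]
          exact mul_le_mul_of_nonneg_left (hFB x y y') (mul_nonneg (abs_nonneg _) (hP y y'))
      _ = B * mixDist P μ k (x n) := by
          simp_rw [← Finset.sum_mul, ← Finset.mul_sum, hP1, mul_one]
          rw [mul_comm]; rfl
      _ ≤ B * ε := mul_le_mul_of_nonneg_left (hmix _) hB
  calc ∫ ω, ∑ y, ∑ y', (P ^ k) (s n ω) y * P y y' * F (fun t => s t ω) y y' ∂ℙ
      ≤ ∫ _, B * ε ∂ℙ := hs.integral_mono_of_le (n := n) (k := 0)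
        (f := fun x => ∑ y, ∑ y', (P ^ k) (x n) y * P y y' * F x y y') (g := fun _ => B * ε)
        (.sum _ fun y => .sum _ fun y' =>
          (hF y y').map₂ (.coord le_rfl) fun u z => (P ^ k) z y * P y y' * u) (fun _ _ _ => rfl) hpt
    _ = B * ε := by simp

end IsMarkovChain
-- One-step inequalities along a single path.
namespace Model

variable {S A : Type*} [Fintype S] [Fintype A] {d : ℕ}

/-- The standing assumptions on the data of a run of the algorithm with step sizes `α` and
`ρ₀ * α`. -/
structure IsRun (m : Model S A d) (ρ₀ : ℝ) (α : ℕ → ℝ) (Rw Rθ : ℝ)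
    (w₀ θ₀ : EuclideanSpace ℝ (Fin d)) : Prop where
  features : m.GoodFeatures
  ratio_nonneg : 0 ≤ ρ₀
  ratio_le_one : ρ₀ ≤ 1
  step_nonneg : ∀ t, 0 ≤ α t
  step_le_one : ∀ t, α t ≤ 1
  step_antitone : Antitone α
  one_le_radius : 1 ≤ Rw
  radius_pos : 0 < Rθ
  norm_w_le : ‖w₀‖ ≤ 1
  norm_θ_le : ‖θ₀‖ ≤ Rθ

lemma dependsUpTo_iterates (m : Model S A d) (α β : ℕ → ℝ) (Rw Rθ : ℝ)
    (w₀ θ₀ : EuclideanSpace ℝ (Fin d)) (t : ℕ) :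
    DependsUpTo t fun x => m.iterates α β Rw Rθ w₀ θ₀ x t := by
  induction t with
  | zero => exact .const _
  | succ t ih =>
    intro x y h
    have h1 := ih.mono t.le_succ x y h
    simp only [iterates] at h1 ⊢
    rw [h1, h t t.le_succ, h (t + 1) le_rfl]

namespace IsRun

variable {m : Model S A d} {ρ₀ : ℝ} {α : ℕ → ℝ} {Rw Rθ : ℝ}
  {w₀ θ₀ : EuclideanSpace ℝ (Fin d)} (h : m.IsRun ρ₀ α Rw Rθ w₀ θ₀) (x : ℕ → S)

local notation "Z" => fun t => m.iterates α (fun t => ρ₀ * α t) Rw Rθ w₀ θ₀ x t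

include h

lemma ratio_mul_step_le_one (t : ℕ) : ρ₀ * α t ≤ 1 :=
  mul_le_one₀ h.ratio_le_one (h.step_nonneg t) (h.step_le_one t)

/-- The `w`-update is a convex combination of `w` and a feature, both in the unit ball. Hence the
iterates stay there and, as `Rw ≥ 1`, the projection of `w` never acts. -/
lemma norm_convexComb_le {w : EuclideanSpace ℝ (Fin d)} (hw : ‖w‖ ≤ 1) (s : S) (t : ℕ) :
    ‖w + (ρ₀ * α t) • m.fUpd s w‖ ≤ 1 := by
  have h0 := mul_nonneg h.ratio_nonneg (h.step_nonneg t)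
  have h1 := h.ratio_mul_step_le_one t
  have e : w + (ρ₀ * α t) • m.fUpd s w = (1 - ρ₀ * α t) • w + (ρ₀ * α t) • m.φ s := by
    simp only [fUpd]; module
  rw [e]
  refine (norm_add_le _ _).trans ?_
  rw [norm_smul, norm_smul, Real.norm_of_nonneg h0, Real.norm_of_nonneg (sub_nonneg.2 h1)]
  nlinarith [h.features.norm_le_one s]

lemma norm_fst_le (t : ℕ) : ‖(Z t).1‖ ≤ 1 := by
  induction t with
  | zero => exact h.norm_w_le
  | succ t ih =>
    have h1 := h.norm_convexComb_le ih (x t) t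
    change ‖projBall Rw _‖ ≤ 1
    rw [projBall_of_norm_le (h1.trans h.one_le_radius)]
    exact h1

lemma fst_succ (t : ℕ) : (Z (t + 1)).1 = (Z t).1 + (ρ₀ * α t) • m.fUpd (x t) (Z t).1 :=
  projBall_of_norm_le
    ((h.norm_convexComb_le (h.norm_fst_le x t) (x t) t).trans h.one_le_radius)

lemma norm_snd_le (t : ℕ) : ‖(Z t).2‖ ≤ Rθ := by
  cases t with
  | zero => exact h.norm_θ_le
  | succ t => exact norm_projBall_le h.radius_pos.le _

lemma norm_fUpd_le (t : ℕ) (s : S) : ‖m.fUpd s (Z t).1‖ ≤ 2 := by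
  refine (norm_sub_le _ _).trans ?_
  linarith [h.features.norm_le_one s, h.norm_fst_le x t]

lemma norm_fst_succ_sub_le (t : ℕ) : ‖(Z (t + 1)).1 - (Z t).1‖ ≤ 2 * ρ₀ * α t := by
  have h0 := mul_nonneg h.ratio_nonneg (h.step_nonneg t)
  rw [h.fst_succ, add_sub_cancel_left, norm_smul, Real.norm_of_nonneg h0]
  nlinarith [h.norm_fUpd_le x t (x t)]

lemma norm_snd_succ_sub_le (t : ℕ) :
    ‖(Z (t + 1)).2 - (Z t).2‖ ≤ (2 * m.rMax + 3 * Rθ) * α t := by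
  refine (norm_projBall_sub_le h.radius_pos.le _ (h.norm_snd_le x t)).trans ?_
  rw [add_sub_cancel_left, norm_smul, Real.norm_of_nonneg (h.step_nonneg t), mul_comm]
  exact mul_le_mul_of_nonneg_right (norm_gUpd_le h.features _ _ (h.norm_fst_le x t)
    (h.norm_snd_le x t)) (h.step_nonneg t)

lemma norm_sub_le_of_succ {E : Type*} [SeminormedAddCommGroup E] {c : ℝ} (hc : 0 ≤ c)
    (u : ℕ → E) (hu : ∀ t, ‖u (t + 1) - u t‖ ≤ c * α t) (n k : ℕ) :
    ‖u (n + k) - u n‖ ≤ k * (c * α n) := by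
  induction k with
  | zero => simp
  | succ k ih =>
    have h1 := hu (n + k)
    have h2 := mul_le_mul_of_nonneg_left (h.step_antitone (Nat.le_add_right n k)) hc
    have h3 := norm_sub_le_norm_sub_add_norm_sub (u (n + (k + 1))) (u (n + k)) (u n)
    push_cast
    rw [← add_assoc] at h3 ⊢
    linarith

/-- Step sizes decrease, so the oldest one bounds every increment over the lag; `hα` trades it for
twice the current one. -/
lemma norm_fst_add_sub_le (n k : ℕ) (hα : α n ≤ 2 * α (n + k)) :
    ‖(Z (n + k)).1 - (Z n).1‖ ≤ 4 * k * (ρ₀ * α (n + k)) := by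
  have h0 := h.ratio_nonneg
  refine (h.norm_sub_le_of_succ (by positivity) (fun t => (Z t).1)
    (h.norm_fst_succ_sub_le x) n k).trans ?_
  calc k * (2 * ρ₀ * α n) ≤ k * (2 * ρ₀ * (2 * α (n + k))) := by gcongr
    _ = _ := by ring

lemma norm_snd_add_sub_le (n k : ℕ) (hα : α n ≤ 2 * α (n + k)) :
    ‖(Z (n + k)).2 - (Z n).2‖ ≤ 2 * k * (2 * m.rMax + 3 * Rθ) * α (n + k) := by
  have h0 := h.radius_pos
  have h1 := m.rMax_nonneg
  refine (h.norm_sub_le_of_succ (by positivity) (fun t => (Z t).2)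
    (h.norm_snd_succ_sub_le x) n k).trans ?_
  calc k * ((2 * m.rMax + 3 * Rθ) * α n)
      ≤ k * ((2 * m.rMax + 3 * Rθ) * (2 * α (n + k))) := by gcongr
    _ = _ := by ring

variable {μ : S → ℝ} (hμ : IsStationaryDist m.P μ)

include hμ

lemma norm_fst_sub_wStar_le (t : ℕ) : ‖(Z t).1 - m.wStar μ‖ ≤ 2 := by
  refine (norm_sub_le _ _).trans ?_
  linarith [h.norm_fst_le x t, norm_wStar_le hμ h.features]

/-- One step of the `w`-error, with the noise evaluated at an earlier iterate. -/
lemma norm_sq_fst_succ_le (n k : ℕ) (hα : α n ≤ 2 * α (n + k)) :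
    ‖(Z (n + k + 1)).1 - m.wStar μ‖ ^ 2
      ≤ (1 - 2 * (ρ₀ * α (n + k))) * ‖(Z (n + k)).1 - m.wStar μ‖ ^ 2
        + 2 * (ρ₀ * α (n + k)) * inner ℝ (m.φ (x (n + k)) - m.wStar μ) ((Z n).1 - m.wStar μ)
        + (16 * k + 4) * (ρ₀ * α (n + k)) ^ 2 := by
  have h1 := h.norm_fst_add_sub_le x n k hα
  have h2 := h.norm_fUpd_le x (n + k) (x (n + k))
  have h0 := mul_nonneg h.ratio_nonneg (h.step_nonneg (n + k))
  have h3 : ‖m.φ (x (n + k)) - m.wStar μ‖ ≤ 2 := by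
    refine (norm_sub_le _ _).trans ?_
    linarith [h.features.norm_le_one (x (n + k)), norm_wStar_le hμ h.features]
  rw [h.fst_succ x (n + k)]
  beta_reduce at h1 h2 ⊢
  set b := ρ₀ * α (n + k)
  set w := (m.iterates α (fun t => ρ₀ * α t) Rw Rθ w₀ θ₀ x (n + k)).1
  set v := (m.iterates α (fun t => ρ₀ * α t) Rw Rθ w₀ θ₀ x n).1
  have e1 : w + b • m.fUpd (x (n + k)) w - m.wStar μ
      = (w - m.wStar μ) + b • m.fUpd (x (n + k)) w := by abel
  -- Write `φ - w = (φ - w*) - (w - w*)`: the second part contracts. In the first the current `w` is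
  -- exchanged for the older `v` at cost `2 · 4kb`, the source of `16k`; the remaining 4 bounds `‖φ
  -- - w‖²`.
  have e2 : inner ℝ (w - m.wStar μ) (m.fUpd (x (n + k)) w)
      = inner ℝ (m.φ (x (n + k)) - m.wStar μ) (v - m.wStar μ)
        + inner ℝ (m.φ (x (n + k)) - m.wStar μ) (w - v) - ‖w - m.wStar μ‖ ^ 2 := by
    rw [← inner_add_right, ← real_inner_self_eq_norm_sq, real_inner_comm]
    rw [show v - m.wStar μ + (w - v) = w - m.wStar μ by abel, ← inner_sub_left]
    congr 1
    simp only [fUpd]; abel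
  have h4 : inner ℝ (m.φ (x (n + k)) - m.wStar μ) (w - v) ≤ 2 * (4 * k * b) :=
    (real_inner_le_norm _ _).trans (mul_le_mul h3 h1 (norm_nonneg _) (by norm_num))
  rw [e1, norm_add_sq_real, inner_smul_right, norm_smul, Real.norm_of_nonneg h0, e2, mul_pow]
  have h5 : ‖m.fUpd (x (n + k)) w‖ ^ 2 ≤ 4 := by nlinarith [norm_nonneg (m.fUpd (x (n + k)) w)]
  nlinarith [mul_le_mul_of_nonneg_left h4 h0, mul_le_mul_of_nonneg_left h5 (sq_nonneg b)]

/-- One step of the `θ`-error, with the noise evaluated at an earlier iterate. -/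
lemma norm_sq_snd_succ_le [DecidableEq S] {θstar : EuclideanSpace ℝ (Fin d)} {lam : ℝ}
    (hfix : m.IsFixedPoint μ θstar) (hθ : ‖θstar‖ ≤ Rθ) (hlam : 0 < lam)
    (n k : ℕ) (hα : α n ≤ 2 * α (n + k)) :
    ‖(Z (n + k + 1)).2 - θstar‖ ^ 2
      ≤ (1 - 2 * α (n + k) * c₁ (m.eta μ) m.rMax Rθ lam) * ‖(Z (n + k)).2 - θstar‖ ^ 2
        + α (n + k) * c₂ m.rMax Rθ lam * ‖(Z (n + k)).1 - m.wStar μ‖ ^ 2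
        + 2 * α (n + k) * inner ℝ (m.gUpd (x (n + k)) (x (n + k + 1)) (Z n).1 (Z n).2
            - m.gBar μ (Z n).1 (Z n).2) ((Z n).2 - θstar)
        + (((48 + 32 * ρ₀) * k + 4) * (m.rMax + 3 * Rθ) ^ 2) * α (n + k) ^ 2 := by
  have hR := h.radius_pos
  have hr := m.rMax_nonneg
  have hρ := h.ratio_nonneg
  have h1 := h.norm_fst_add_sub_le x n k hα
  have h2 := h.norm_snd_add_sub_le x n k hα
  have ha := h.step_nonneg (n + k)
  have hstep := norm_projBall_sub_le h.radius_pos.le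
    ((Z (n + k)).2 + α (n + k) • m.gUpd (x (n + k)) (x (n + k + 1)) (Z (n + k)).1 (Z (n + k)).2) hθ
  have hw := h.norm_fst_le x (n + k)
  have hv := h.norm_fst_le x n
  have ht := h.norm_snd_le x (n + k)
  have hu := h.norm_snd_le x n
  change ‖projBall Rθ ((Z (n + k)).2
    + α (n + k) • m.gUpd (x (n + k)) (x (n + k + 1)) (Z (n + k)).1 (Z (n + k)).2) - θstar‖ ^ 2 ≤ _
  beta_reduce at *
  set a := α (n + k)
  set w := (m.iterates α (fun t => ρ₀ * α t) Rw Rθ w₀ θ₀ x (n + k)).1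
  set v := (m.iterates α (fun t => ρ₀ * α t) Rw Rθ w₀ θ₀ x n).1
  set θ := (m.iterates α (fun t => ρ₀ * α t) Rw Rθ w₀ θ₀ x (n + k)).2
  set u := (m.iterates α (fun t => ρ₀ * α t) Rw Rθ w₀ θ₀ x n).2
  set s := x (n + k)
  set s' := x (n + k + 1)
  set r := m.rMax
  have hg := norm_gUpd_le h.features s s' hw ht
  have hgn : ‖m.gUpd s s' v u - m.gBar μ v u‖ ≤ 2 * (2 * r + 3 * Rθ) := by
    refine (norm_sub_le _ _).trans ?_
    linarith [norm_gUpd_le h.features s s' hv hu, norm_gBar_le hμ h.features hv hu]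
  have hgd : ‖(m.gUpd s s' w θ - m.gBar μ w θ) - (m.gUpd s s' v u - m.gBar μ v u)‖
      ≤ 2 * (3 * ‖θ - u‖ + (r + Rθ) * ‖w - v‖) := by
    rw [sub_sub_sub_comm]
    refine (norm_sub_le _ _).trans ?_
    linarith [norm_gUpd_sub_le h.features s s' (w := w) (θ' := u) hv ht,
      norm_gBar_sub_le hμ h.features (w := w) (θ' := u) hv ht]
  have hx : ‖θ - θstar‖ ≤ 2 * Rθ := (norm_sub_le _ _).trans (by linarith)
  have hdrift := inner_gBar_le hμ h.features (w := w) hfix ht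
  -- Mean drift, plus noise taken entirely at time `n`, plus two corrections for the lag: one from
  -- `θ - u`, one from the change of the noise between times `n` and `n + k`.
  have e : inner ℝ (θ - θstar) (m.gUpd s s' w θ)
      = inner ℝ (m.gBar μ w θ) (θ - θstar)
        + inner ℝ (m.gUpd s s' v u - m.gBar μ v u) (u - θstar)
        + inner ℝ (m.gUpd s s' v u - m.gBar μ v u) (θ - u)
        + inner ℝ ((m.gUpd s s' w θ - m.gBar μ w θ) - (m.gUpd s s' v u - m.gBar μ v u))
            (θ - θstar) := by
    rw [add_assoc (inner ℝ (m.gBar μ w θ) (θ - θstar)), ← inner_add_right,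
      show u - θstar + (θ - u) = θ - θstar by abel, ← inner_add_left, ← inner_add_left,
      real_inner_comm]
    congr 1
    abel
  have i1 : inner ℝ (m.gUpd s s' v u - m.gBar μ v u) (θ - u)
      ≤ 2 * (2 * r + 3 * Rθ) * (2 * k * (2 * r + 3 * Rθ) * a) :=
    (real_inner_le_norm _ _).trans (mul_le_mul hgn h2 (norm_nonneg _) (by positivity))
  have i2 : inner ℝ ((m.gUpd s s' w θ - m.gBar μ w θ) - (m.gUpd s s' v u - m.gBar μ v u))
      (θ - θstar)
      ≤ 2 * (3 * (2 * k * (2 * r + 3 * Rθ) * a) + (r + Rθ) * (4 * k * (ρ₀ * a))) * (2 * Rθ) := by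
    refine (real_inner_le_norm _ _).trans (mul_le_mul (hgd.trans ?_) hx (norm_nonneg _) ?_)
    · gcongr
    · positivity
  have i3 : 2 * (2 * r + 3 * Rθ) * (2 * k * (2 * r + 3 * Rθ) * a)
      + 2 * (3 * (2 * k * (2 * r + 3 * Rθ) * a) + (r + Rθ) * (4 * k * (ρ₀ * a))) * (2 * Rθ)
      ≤ (24 + 16 * ρ₀) * k * (r + 3 * Rθ) ^ 2 * a := by
    -- This quantity is exactly the right side minus the left side.
    have : 0 ≤ k * a * (8 * r ^ 2 + 48 * r * Rθ + 108 * Rθ ^ 2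
        + 16 * ρ₀ * (r ^ 2 + 5 * r * Rθ + 8 * Rθ ^ 2)) := by positivity
    nlinarith
  -- Young's inequality with weight `λ²`; `r + Rθ` is enlarged to `r + 2Rθ` to match `c₁` and `c₂`.
  have i4 : (r + Rθ) * (‖w - m.wStar μ‖ * ‖θ - θstar‖)
      ≤ lam ^ 2 * (r + 2 * Rθ) / 2 * ‖θ - θstar‖ ^ 2
        + c₂ r Rθ lam / 2 * ‖w - m.wStar μ‖ ^ 2 := by
    have hF : (r + Rθ) * (‖w - m.wStar μ‖ * ‖θ - θstar‖)
        ≤ (r + 2 * Rθ) * (‖w - m.wStar μ‖ * ‖θ - θstar‖) := by gcongr; linarith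
    have hY : ‖w - m.wStar μ‖ * ‖θ - θstar‖
        ≤ lam ^ 2 / 2 * ‖θ - θstar‖ ^ 2 + ‖w - m.wStar μ‖ ^ 2 / lam ^ 2 / 2 := by
      have := two_mul_le_add_sq (lam * ‖θ - θstar‖) (‖w - m.wStar μ‖ / lam)
      have e5 : 2 * (lam * ‖θ - θstar‖) * (‖w - m.wStar μ‖ / lam)
          = 2 * (‖w - m.wStar μ‖ * ‖θ - θstar‖) := by field_simp
      rw [e5, mul_pow, div_pow] at this
      linarith
    calc _ ≤ _ := hF
      _ ≤ (r + 2 * Rθ) * (lam ^ 2 / 2 * ‖θ - θstar‖ ^ 2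
          + ‖w - m.wStar μ‖ ^ 2 / lam ^ 2 / 2) := by gcongr
      _ = _ := by rw [c₂]; ring
  have i5 : ‖m.gUpd s s' w θ‖ ^ 2 ≤ 4 * (r + 3 * Rθ) ^ 2 := by
    calc ‖m.gUpd s s' w θ‖ ^ 2 ≤ (2 * (r + 3 * Rθ)) ^ 2 := by gcongr; linarith
      _ = _ := by ring
  have hexp : ‖θ + a • m.gUpd s s' w θ - θstar‖ ^ 2 = ‖θ - θstar‖ ^ 2
      + 2 * a * inner ℝ (θ - θstar) (m.gUpd s s' w θ) + a ^ 2 * ‖m.gUpd s s' w θ‖ ^ 2 := by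
    rw [show θ + a • m.gUpd s s' w θ - θstar = (θ - θstar) + a • m.gUpd s s' w θ by abel,
      norm_add_sq_real, inner_smul_right, norm_smul, Real.norm_of_nonneg ha]
    ring
  have hmain : inner ℝ (θ - θstar) (m.gUpd s s' w θ)
      ≤ -(c₁ (m.eta μ) r Rθ lam) * ‖θ - θstar‖ ^ 2 + c₂ r Rθ lam / 2 * ‖w - m.wStar μ‖ ^ 2
        + inner ℝ (m.gUpd s s' v u - m.gBar μ v u) (u - θstar)
        + (24 + 16 * ρ₀) * k * (r + 3 * Rθ) ^ 2 * a := by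
    rw [e, c₁]
    linarith
  calc _ ≤ ‖θ + a • m.gUpd s s' w θ - θstar‖ ^ 2 := by gcongr
    _ = _ := hexp
    _ ≤ ‖θ - θstar‖ ^ 2 + 2 * a * (-(c₁ (m.eta μ) r Rθ lam) * ‖θ - θstar‖ ^ 2
        + c₂ r Rθ lam / 2 * ‖w - m.wStar μ‖ ^ 2
        + inner ℝ (m.gUpd s s' v u - m.gBar μ v u) (u - θstar)
        + (24 + 16 * ρ₀) * k * (r + 3 * Rθ) ^ 2 * a) + a ^ 2 * (4 * (r + 3 * Rθ) ^ 2) := by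
        gcongr
    _ = _ := by ring

end IsRun

end Model

/-! ### One-step inequalities in expectation. -/

namespace Model

namespace IsRun

variable {S A : Type*} [Fintype S] [DecidableEq S] [Fintype A] {d : ℕ}
  {m : Model S A d} {ρ₀ : ℝ} {α : ℕ → ℝ} {Rw Rθ : ℝ}
  {w₀ θ₀ : EuclideanSpace ℝ (Fin d)} (h : m.IsRun ρ₀ α Rw Rθ w₀ θ₀)
  {μ : S → ℝ} (hμ : IsStationaryDist m.P μ)
  {Ω : Type*} [MeasurableSpace Ω] {ℙ : Measure Ω} [IsProbabilityMeasure ℙ]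
  {s : ℕ → Ω → S} (hs : IsMarkovChain m.P ℙ s)

local notation "Z" => m.iterates α (fun t => ρ₀ * α t) Rw Rθ w₀ θ₀

include hs in
/-- The expectation of a combination of three functionals of the path. -/
lemma integral_le_of_combination {n : ℕ} {f f₁ f₂ f₃ : (ℕ → S) → ℝ} {p₁ p₂ p₃ q e : ℝ}
    (hf : DependsUpTo n f) (hf₁ : DependsUpTo n f₁) (hf₂ : DependsUpTo n f₂)
    (hf₃ : DependsUpTo n f₃)
    (hle : ∀ x, f x ≤ p₁ * f₁ x + p₂ * f₂ x + p₃ * f₃ x + q) (hp₃ : 0 ≤ p₃)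
    (he : ∫ ω, f₃ (fun t => s t ω) ∂ℙ ≤ e) :
    ∫ ω, f (fun t => s t ω) ∂ℙ ≤ p₁ * ∫ ω, f₁ (fun t => s t ω) ∂ℙ
      + p₂ * ∫ ω, f₂ (fun t => s t ω) ∂ℙ + p₃ * e + q := by
  have i₁ := (hs.integrable hf₁).const_mul p₁
  have i₂ := (hs.integrable hf₂).const_mul p₂
  have i₃ := (hs.integrable hf₃).const_mul p₃
  have i₁₂ : Integrable (fun ω => p₁ * f₁ (fun t => s t ω) + p₂ * f₂ (fun t => s t ω)) ℙ :=
    i₁.add i₂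
  have i₁₂₃ : Integrable (fun ω => p₁ * f₁ (fun t => s t ω) + p₂ * f₂ (fun t => s t ω)
      + p₃ * f₃ (fun t => s t ω)) ℙ := i₁₂.add i₃
  calc ∫ ω, f (fun t => s t ω) ∂ℙ
      ≤ ∫ ω, (p₁ * f₁ (fun t => s t ω) + p₂ * f₂ (fun t => s t ω)
          + p₃ * f₃ (fun t => s t ω) + q) ∂ℙ :=
        integral_mono (hs.integrable hf) (i₁₂₃.add (integrable_const q))
          fun _ => hle _
    _ = p₁ * ∫ ω, f₁ (fun t => s t ω) ∂ℙ + p₂ * ∫ ω, f₂ (fun t => s t ω) ∂ℙ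
          + p₃ * ∫ ω, f₃ (fun t => s t ω) ∂ℙ + q := by
        rw [integral_add i₁₂₃ (integrable_const q),
          integral_add i₁₂ i₃, integral_add i₁ i₂, integral_const_mul,
          integral_const_mul, integral_const_mul]
        simp
    _ ≤ _ := by gcongr

include h hμ hs

lemma integral_fst_succ_le (n k : ℕ) (hα : α n ≤ 2 * α (n + k))
    (hmix : ∀ y, mixDist m.P μ k y ≤ ρ₀ * α (n + k)) :
    ∫ ω, ‖(Z (fun t => s t ω) (n + k + 1)).1 - m.wStar μ‖ ^ 2 ∂ℙ
      ≤ (1 - 2 * (ρ₀ * α (n + k)))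
          * ∫ ω, ‖(Z (fun t => s t ω) (n + k)).1 - m.wStar μ‖ ^ 2 ∂ℙ
        + (16 * k + 12) * (ρ₀ * α (n + k)) ^ 2 := by
  have hb := mul_nonneg h.ratio_nonneg (h.step_nonneg (n + k))
  have hZ := fun t => dependsUpTo_iterates m α (fun t => ρ₀ * α t) Rw Rθ w₀ θ₀ t
  -- Both factors of the noise have norm at most 2, whence `B = 4`. The noise adds `2β · 4β`, which
  -- raises the constant 4 of the pathwise bound to 12.
  have hnoise := hs.integral_transition_le m.P_nonneg m.sum_P (n := n) (B := 4) (by norm_num)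
    hmix (F := fun x y _ => inner ℝ (m.φ y - m.wStar μ) ((Z x n).1 - m.wStar μ))
    (fun y _ => (hZ n).map fun z => inner ℝ (m.φ y - m.wStar μ) (z.1 - m.wStar μ))
    (fun x => by
      rw [m.sum_sum_mul_left μ fun y => inner ℝ (m.φ y - m.wStar μ) ((Z x n).1 - m.wStar μ)]
      simp_rw [inner_sub_left, mul_sub, Finset.sum_sub_distrib, ← Finset.sum_mul,
        hμ.sum_eq_one, one_mul]
      simp_rw [inner_wStar, inner_φ]
      exact sub_self _)
    (fun x y _ => by
      refine (abs_real_inner_le_norm _ _).trans ?_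
      have h1 : ‖m.φ y - m.wStar μ‖ ≤ 2 := by
        refine (norm_sub_le _ _).trans ?_
        linarith [h.features.norm_le_one y, norm_wStar_le hμ h.features]
      have h2 := h.norm_fst_sub_wStar_le x hμ n
      calc _ ≤ (2 : ℝ) * 2 := mul_le_mul h1 h2 (norm_nonneg _) (by norm_num)
        _ = 4 := by norm_num)
  have := integral_le_of_combination hs (n := n + k + 1)
    (f := fun x => ‖(Z x (n + k + 1)).1 - m.wStar μ‖ ^ 2)
    (f₁ := fun x => ‖(Z x (n + k)).1 - m.wStar μ‖ ^ 2) (f₂ := fun _ => 0)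
    (f₃ := fun x => inner ℝ (m.φ (x (n + k)) - m.wStar μ) ((Z x n).1 - m.wStar μ))
    (p₂ := 0)
    ((hZ _).map fun z => ‖z.1 - m.wStar μ‖ ^ 2)
    (((hZ _).mono (by omega)).map fun z => ‖z.1 - m.wStar μ‖ ^ 2) (.const 0)
    (((DependsUpTo.coord (by omega))).map₂ ((hZ _).mono (by omega))
      fun y z => inner ℝ (m.φ y - m.wStar μ) (z.1 - m.wStar μ))
    (fun x => by simpa using h.norm_sq_fst_succ_le x hμ n k hα) (by positivity) hnoise
  refine this.trans (le_of_eq ?_)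
  ring

lemma integral_snd_succ_le {θstar : EuclideanSpace ℝ (Fin d)} {lam : ℝ}
    (hfix : m.IsFixedPoint μ θstar) (hθ : ‖θstar‖ ≤ Rθ) (hlam : 0 < lam)
    (n k : ℕ) (hα : α n ≤ 2 * α (n + k)) (hmix : ∀ y, mixDist m.P μ k y ≤ α (n + k)) :
    ∫ ω, ‖(Z (fun t => s t ω) (n + k + 1)).2 - θstar‖ ^ 2 ∂ℙ
      ≤ (1 - 2 * α (n + k) * c₁ (m.eta μ) m.rMax Rθ lam)
          * ∫ ω, ‖(Z (fun t => s t ω) (n + k)).2 - θstar‖ ^ 2 ∂ℙ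
        + α (n + k) * c₂ m.rMax Rθ lam
          * ∫ ω, ‖(Z (fun t => s t ω) (n + k)).1 - m.wStar μ‖ ^ 2 ∂ℙ
        + (((48 + 32 * ρ₀) * k + 8) * (m.rMax + 3 * Rθ) ^ 2) * α (n + k) ^ 2 := by
  have ha := h.step_nonneg (n + k)
  have hr := m.rMax_nonneg
  have hR := h.radius_pos
  have hZ := fun t => dependsUpTo_iterates m α (fun t => ρ₀ * α t) Rw Rθ w₀ θ₀ t
  -- The product `2(2r + 3Rθ) · 2Rθ` is at most `2(r + 3Rθ)²`. The noise adds `2α` times this times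
  -- `α`, raising the constant 4 to 8.
  have hnoise := hs.integral_transition_le m.P_nonneg m.sum_P (n := n)
    (B := 2 * (m.rMax + 3 * Rθ) ^ 2) (by positivity) hmix
    (F := fun x y y' => inner ℝ (m.gUpd y y' (Z x n).1 (Z x n).2
      - m.gBar μ (Z x n).1 (Z x n).2) ((Z x n).2 - θstar))
    (fun y y' => (hZ n).map fun z => inner ℝ (m.gUpd y y' z.1 z.2 - m.gBar μ z.1 z.2)
      (z.2 - θstar))
    (fun x => by
      simp_rw [inner_sub_left, mul_sub, Finset.sum_sub_distrib, ← Finset.sum_mul]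
      rw [sum_sum_mul_P hμ, one_mul, gBar_eq_sum]
      simp_rw [sum_inner, inner_smul_left]
      simp)
    (fun x y y' => by
      refine (abs_real_inner_le_norm _ _).trans ?_
      have hv := h.norm_fst_le x n
      have hu := h.norm_snd_le x n
      have h1 : ‖m.gUpd y y' (Z x n).1 (Z x n).2 - m.gBar μ (Z x n).1 (Z x n).2‖
          ≤ 2 * (2 * m.rMax + 3 * Rθ) := by
        refine (norm_sub_le _ _).trans ?_
        linarith [norm_gUpd_le h.features y y' hv hu, norm_gBar_le hμ h.features hv hu]
      have h2 : ‖(Z x n).2 - θstar‖ ≤ 2 * Rθ := (norm_sub_le _ _).trans (by linarith)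
      refine (mul_le_mul h1 h2 (norm_nonneg _) (by positivity)).trans ?_
      nlinarith [mul_nonneg hr hR.le, sq_nonneg m.rMax, sq_nonneg Rθ])
  have := integral_le_of_combination hs (n := n + k + 1)
    (f := fun x => ‖(Z x (n + k + 1)).2 - θstar‖ ^ 2)
    (f₁ := fun x => ‖(Z x (n + k)).2 - θstar‖ ^ 2)
    (f₂ := fun x => ‖(Z x (n + k)).1 - m.wStar μ‖ ^ 2)
    (f₃ := fun x => inner ℝ (m.gUpd (x (n + k)) (x (n + k + 1)) (Z x n).1 (Z x n).2
      - m.gBar μ (Z x n).1 (Z x n).2) ((Z x n).2 - θstar))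
    ((hZ _).map fun z => ‖z.2 - θstar‖ ^ 2)
    (((hZ _).mono (by omega)).map fun z => ‖z.2 - θstar‖ ^ 2)
    (((hZ _).mono (by omega)).map fun z => ‖z.1 - m.wStar μ‖ ^ 2)
    ((((DependsUpTo.coord (i := n + k) (by omega))).map₂ (DependsUpTo.coord (i := n + k + 1)
      le_rfl) fun y y' => (y, y')).map₂ ((hZ n).mono (by omega))
      fun (y : S × S) z => inner ℝ (m.gUpd y.1 y.2 z.1 z.2 - m.gBar μ z.1 z.2) (z.2 - θstar))
    (fun x => h.norm_sq_snd_succ_le x hμ hfix hθ hlam n k hα) (by positivity) hnoise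
  refine this.trans (le_of_eq ?_)
  ring

lemma integral_fst_le (t : ℕ) :
    ∫ ω, ‖(Z (fun t => s t ω) t).1 - m.wStar μ‖ ^ 2 ∂ℙ ≤ 4 := by
  have hZ := dependsUpTo_iterates m α (fun t => ρ₀ * α t) Rw Rθ w₀ θ₀ t
  calc _ ≤ ∫ _, (4 : ℝ) ∂ℙ := hs.integral_mono_of_le (k := 0)
        (hZ.map fun z => ‖z.1 - m.wStar μ‖ ^ 2) (.const 4) fun x => by
          nlinarith [h.norm_fst_sub_wStar_le x hμ t, norm_nonneg ((Z x t).1 - m.wStar μ)]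
    _ = 4 := by simp

omit hμ in
lemma integral_snd_le {θstar : EuclideanSpace ℝ (Fin d)} (hθ : ‖θstar‖ ≤ Rθ) (t : ℕ) :
    ∫ ω, ‖(Z (fun t => s t ω) t).2 - θstar‖ ^ 2 ∂ℙ ≤ 4 * Rθ ^ 2 := by
  have hZ := dependsUpTo_iterates m α (fun t => ρ₀ * α t) Rw Rθ w₀ θ₀ t
  calc _ ≤ ∫ _, (4 * Rθ ^ 2 : ℝ) ∂ℙ := hs.integral_mono_of_le (k := 0)
        (hZ.map fun z => ‖z.2 - θstar‖ ^ 2) (.const _) fun x => by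
          have : ‖(Z x t).2 - θstar‖ ≤ 2 * Rθ :=
            (norm_sub_le _ _).trans (by linarith [h.norm_snd_le x t])
          nlinarith [norm_nonneg ((Z x t).2 - θstar)]
    _ = _ := by simp

end IsRun

end Model

/-! ### Mixing times under geometric mixing. -/

section MixingTime

variable {S : Type*} [Fintype S] [DecidableEq S] {P : Matrix S S ℝ} {μ : S → ℝ} {C b : ℝ}

lemma one_le_L₁ (C b : ℝ) : 1 ≤ L₁ C b := le_max_left _ _

variable (hmix : ∀ (k : ℕ) (s : S), mixDist P μ k s ≤ C * b ^ k) (hC : 1 < C) (hb0 : 0 ≤ b)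
  (hb1 : b < 1)

include hmix hC hb0 hb1

/-- The geometric mixing bound controls the mixing time. -/
lemma exists_mixDist_le {ε : ℝ} (hε : 0 < ε) (hε1 : ε ≤ Real.exp (-1)) :
    ∃ k : ℕ, (∀ s, mixDist P μ k s ≤ ε) ∧ (k : ℝ) ≤ L₁ C b * (1 - Real.log ε) := by
  have hX : Real.log ε ≤ -1 := by
    rw [← Real.log_exp (-1)]; exact Real.log_le_log hε hε1
  have hL := one_le_L₁ C b
  rcases hb0.eq_or_lt with rfl | hb
  -- For `b = 0` one step suffices, as `C · 0¹ = 0`.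
  · refine ⟨1, fun s => (hmix 1 s).trans (by simpa using hε.le), ?_⟩
    push_cast
    nlinarith
  have hl : 0 < Real.log (1 / b) := Real.log_pos (by rw [lt_div_iff₀ hb]; linarith)
  have hlC : 0 < Real.log C := Real.log_pos hC
  have hq : 0 ≤ (Real.log C - Real.log ε) / Real.log (1 / b) := by
    apply div_nonneg _ hl.le; linarith
  refine ⟨⌈(Real.log C - Real.log ε) / Real.log (1 / b)⌉₊, fun s => (hmix _ s).trans ?_, ?_⟩
  · set k := ⌈(Real.log C - Real.log ε) / Real.log (1 / b)⌉₊
    have hk : Real.log C - Real.log ε ≤ k * Real.log (1 / b) := by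
      rw [← div_le_iff₀ hl]; exact Nat.le_ceil _
    rw [← Real.log_le_log_iff (by positivity) hε, Real.log_mul (by positivity) (by positivity),
      Real.log_pow]
    rw [one_div, Real.log_inv] at hk
    linarith
  · refine (Nat.ceil_lt_add_one hq).le.trans ?_
    -- Since `-log ε ≥ 1`, `log C - log ε ≤ (log C + 1)(-log ε)`; this is where `ε ≤ 1/e` enters.
    -- The ceiling costs a further `1 ≤ L₁`.
    have h1 : (Real.log C - Real.log ε) / Real.log (1 / b)
        ≤ L₁ C b * (-Real.log ε) := by
      have h2 : (Real.log C + 1) / Real.log (1 / b) ≤ L₁ C b := le_max_right _ _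
      refine le_trans ?_ (mul_le_mul_of_nonneg_right h2 (by linarith))
      rw [div_mul_eq_mul_div]
      gcongr
      nlinarith
    linarith

/-- The infimum is attained because the set is nonempty; an empty one would give the default value
0. -/
lemma mixDist_mixingTime_le {ε : ℝ} (hε : 0 < ε) (hε1 : ε ≤ Real.exp (-1)) (s : S) :
    mixDist P μ (mixingTime P μ ε) s ≤ ε := by
  obtain ⟨k, hk, -⟩ := exists_mixDist_le hmix hC hb0 hb1 hε hε1
  exact Nat.sInf_mem (s := {k : ℕ | ∀ s, mixDist P μ k s ≤ ε}) ⟨k, hk⟩ s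

lemma mixingTime_le {ε : ℝ} (hε : 0 < ε) (hε1 : ε ≤ Real.exp (-1)) :
    (mixingTime P μ ε : ℝ) ≤ L₁ C b * (1 - Real.log ε) := by
  obtain ⟨k, hk, hk'⟩ := exists_mixDist_le hmix hC hb0 hb1 hε hε1
  exact le_trans (Nat.cast_le.2 (Nat.sInf_le hk)) hk'

lemma mixingTime_anti {ε ε' : ℝ} (hε : 0 < ε) (hε1 : ε ≤ Real.exp (-1)) (h : ε ≤ ε') :
    mixingTime P μ ε' ≤ mixingTime P μ ε :=
  Nat.sInf_le fun s => (mixDist_mixingTime_le hmix hC hb0 hb1 hε hε1 s).trans h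

end MixingTime

/-! ### Elementary inequalities for real powers. -/

section Powers

variable {u p s ξ : ℝ}

/-- `(1 - p / u) (u + 1)ᵖ ≤ uᵖ`. -/
lemma one_sub_div_mul_add_one_rpow_le (hu : 0 < u) (hp : 0 ≤ p) :
    (1 - p / u) * (u + 1) ^ p ≤ u ^ p := by
  have h1 : (u + 1) ^ p = u ^ p * (1 + 1 / u) ^ p := by
    rw [← Real.mul_rpow hu.le (by positivity)]
    congr 1; field_simp
  have h2 : (1 + 1 / u) ^ p ≤ Real.exp (p / u) := by
    calc (1 + 1 / u) ^ p ≤ Real.exp (1 / u) ^ p := by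
          gcongr; linarith [Real.add_one_le_exp (1 / u)]
      _ = Real.exp (p / u) := by rw [← Real.exp_mul]; congr 1; ring
  have h3 : 1 - p / u ≤ Real.exp (-(p / u)) := by linarith [Real.add_one_le_exp (-(p / u))]
  calc (1 - p / u) * (u + 1) ^ p ≤ Real.exp (-(p / u)) * (u + 1) ^ p := by gcongr
    _ ≤ Real.exp (-(p / u)) * (u ^ p * Real.exp (p / u)) := by rw [h1]; gcongr
    _ = u ^ p := by rw [mul_comm (u ^ p), ← mul_assoc, ← Real.exp_add]; simp

/-- Telescoping bound for the series of negative powers. -/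
lemma mul_rpow_neg_le (hu : 1 < u) (hs : 0 ≤ s) :
    s * u ^ (-s - 1) ≤ (u - 1) ^ (-s) - u ^ (-s) := by
  have hu0 : 0 < u := by linarith
  have h1u : 0 < 1 - 1 / u := by rw [sub_pos, div_lt_one hu0]; exact hu
  have h1 : (u - 1) ^ (-s) = u ^ (-s) * (1 - 1 / u) ^ (-s) := by
    rw [← Real.mul_rpow hu0.le h1u.le]
    congr 1; field_simp
  have h2 : Real.exp (s / u) ≤ (1 - 1 / u) ^ (-s) := by
    calc Real.exp (s / u) = Real.exp (-(1 / u)) ^ (-s) := by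
          rw [← Real.exp_mul]; congr 1; ring
      _ ≤ (1 - 1 / u) ^ (-s) :=
          Real.rpow_le_rpow_of_nonpos h1u (by linarith [Real.add_one_le_exp (-(1 / u))])
            (by linarith)
  have h3 := Real.add_one_le_exp (s / u)
  have h4 : u ^ (-s - 1) = u ^ (-s) / u := Real.rpow_sub_one hu0.ne' _
  have h5 : u ^ (-s) * (s / u + 1) ≤ u ^ (-s) * (1 - 1 / u) ^ (-s) := by
    gcongr; exact h3.trans h2
  rw [h1, h4]
  calc s * (u ^ (-s) / u) = u ^ (-s) * (s / u + 1) - u ^ (-s) := by ring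
    _ ≤ _ := by linarith

lemma one_div_le_log_sub_log (hu : 1 < u) : 1 / u ≤ Real.log u - Real.log (u - 1) := by
  have hu0 : 0 < u := by linarith
  have h := Real.log_le_sub_one_of_pos (x := (u - 1) / u) (by apply div_pos <;> linarith)
  rw [Real.log_div (by linarith) hu0.ne'] at h
  have : (u - 1) / u = 1 - 1 / u := by field_simp
  linarith

lemma add_one_rpow_le (hu : 1 ≤ u) (hp : 0 ≤ p) : (u + 1) ^ p ≤ 2 ^ p * u ^ p := by
  rw [← Real.mul_rpow (by norm_num) (by linarith)]
  gcongr
  linarith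

/-- `(u + 1) ^ ξ ≤ u ^ ξ (1 + ξ / u)` in the form used for step sizes. -/
lemma div_rpow_mul_le (hu : 1 ≤ u) (h0 : 0 ≤ ξ) (h1 : ξ ≤ 1) {a : ℝ} (ha : 0 ≤ a) :
    a / u ^ ξ * (1 - ξ / u) ≤ a / (u + 1) ^ ξ := by
  have hu0 : 0 < u := by linarith
  have h2 : (u + 1) ^ ξ = u ^ ξ * (1 + 1 / u) ^ ξ := by
    rw [← Real.mul_rpow hu0.le (by positivity)]
    congr 1; field_simp
  have h3 : (1 + 1 / u) ^ ξ ≤ 1 + ξ * (1 / u) :=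
    _root_.rpow_one_add_le_one_add_mul_self
      (by linarith [show 0 ≤ 1 / u by positivity]) h0 h1
  have h4 : 0 < (1 + 1 / u) ^ ξ := by positivity
  have h5 : 0 ≤ 1 - ξ / u := by rw [sub_nonneg, div_le_one hu0]; linarith
  rw [h2, ← div_div, le_div_iff₀ h4, mul_assoc]
  have h6 : (1 - ξ / u) * (1 + 1 / u) ^ ξ ≤ 1 := by
    calc (1 - ξ / u) * (1 + 1 / u) ^ ξ ≤ (1 - ξ / u) * (1 + ξ * (1 / u)) := by gcongr
      _ = 1 - (ξ / u) ^ 2 := by ring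
      _ ≤ 1 := by linarith [sq_nonneg (ξ / u)]
  calc a / u ^ ξ * ((1 - ξ / u) * (1 + 1 / u) ^ ξ) ≤ a / u ^ ξ * 1 := by gcongr
    _ = _ := mul_one _

/-- Paired with `le_add_one_rpow_sub`, this compares step sizes with increments of `u^(1-ξ)`. Both
are Bernoulli's inequality for an exponent in `[0, 1]`, expanded at `u` and at `u + 1` respectively.
-/
lemma add_one_rpow_sub_le (hu : 1 ≤ u) (h0 : 0 ≤ ξ) (h1 : ξ ≤ 1) :
    (u + 1) ^ (1 - ξ) - u ^ (1 - ξ) ≤ (1 - ξ) / u ^ ξ := by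
  have hu0 : 0 < u := by linarith
  have h2 : (u + 1) ^ (1 - ξ) = u ^ (1 - ξ) * (1 + 1 / u) ^ (1 - ξ) := by
    rw [← Real.mul_rpow hu0.le (by positivity)]
    congr 1; field_simp
  have h3 : (1 + 1 / u) ^ (1 - ξ) ≤ 1 + (1 - ξ) * (1 / u) :=
    _root_.rpow_one_add_le_one_add_mul_self
      (by linarith [show 0 ≤ 1 / u by positivity]) (by linarith) (by linarith)
  have h4 : u ^ (1 - ξ) = u / u ^ ξ := by rw [Real.rpow_sub hu0, Real.rpow_one]
  have h5 : u ^ (1 - ξ) * (1 + 1 / u) ^ (1 - ξ) ≤ u ^ (1 - ξ) * (1 + (1 - ξ) * (1 / u)) := by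
    gcongr
  rw [h2]
  calc _ ≤ u ^ (1 - ξ) * (1 + (1 - ξ) * (1 / u)) - u ^ (1 - ξ) := by linarith
    _ = (1 - ξ) / u ^ ξ := by rw [h4]; field_simp; ring

lemma le_add_one_rpow_sub (hu : 1 ≤ u) (h0 : 0 ≤ ξ) (h1 : ξ ≤ 1) :
    (1 - ξ) / (u + 1) ^ ξ ≤ (u + 1) ^ (1 - ξ) - u ^ (1 - ξ) := by
  have hu0 : 0 < u + 1 := by linarith
  have h1u : 0 ≤ 1 + -(1 / (u + 1)) := by
    have : 1 / (u + 1) ≤ 1 := by rw [div_le_one hu0]; linarith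
    linarith
  have h2 : u ^ (1 - ξ) = (u + 1) ^ (1 - ξ) * (1 + -(1 / (u + 1))) ^ (1 - ξ) := by
    rw [← Real.mul_rpow hu0.le h1u]
    congr 1; field_simp; ring
  have h3 : (1 + -(1 / (u + 1))) ^ (1 - ξ) ≤ 1 + (1 - ξ) * (-(1 / (u + 1))) :=
    _root_.rpow_one_add_le_one_add_mul_self (by linarith) (by linarith) (by linarith)
  have h4 : (u + 1) ^ (1 - ξ) = (u + 1) / (u + 1) ^ ξ := by rw [Real.rpow_sub hu0, Real.rpow_one]
  have h5 : (u + 1) ^ (1 - ξ) * (1 + -(1 / (u + 1))) ^ (1 - ξ)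
      ≤ (u + 1) ^ (1 - ξ) * (1 + (1 - ξ) * (-(1 / (u + 1)))) := by
    gcongr
  rw [h2]
  calc (1 - ξ) / (u + 1) ^ ξ
      = (u + 1) ^ (1 - ξ) - (u + 1) ^ (1 - ξ) * (1 + (1 - ξ) * (-(1 / (u + 1)))) := by
        rw [h4]; field_simp; ring
    _ ≤ _ := by linarith

end Powers

/-! ### Solving the scalar recursions. -/

section Recursions

variable {τ T : ℕ} {X Y : ℕ → ℝ}

/-- The two-timescale recursion for slowly decreasing step sizes; `e` is a continuous-time
version of the sum of the step sizes from time `τ` on. -/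
lemma le_of_twoTimescale {α e : ℕ → ℝ} {c₁ c₂ ρ M G H x₀ : ℝ} (hτT : τ ≤ T)
    (hα : ∀ t, 0 ≤ α t) (hαM : ∀ t, α t ≤ M) (heτ : e τ = 0)
    (he : ∀ t, e (t + 1) ≤ e t + α t) (he' : ∀ t, e t + α (t + 1) ≤ e (t + 1))
    (hc₁ : 0 < c₁) (hc₂ : 0 ≤ c₂) (hρ : 0 ≤ ρ) (hH : 0 ≤ H) (hx₀ : 0 ≤ x₀)
    (hα₁ : ∀ t, α t * (1 - c₁ * α t) ≤ α (t + 1)) (hα₂ : ∀ t, α t * (1 - ρ * α t) ≤ α (t + 1))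
    (hb₁ : ∀ t, 0 ≤ 1 - 2 * α t * c₁) (hb₂ : ∀ t, 0 ≤ 1 - 2 * (ρ * α t))
    (hG : 0 ≤ G) (hX₀ : X τ ≤ x₀) (hY₀ : Y τ ≤ 4)
    (hY : ∀ t, τ ≤ t → t < T → Y (t + 1) ≤ (1 - 2 * (ρ * α t)) * Y t + H * (ρ * α t) ^ 2)
    (hX : ∀ t, τ ≤ t → t < T →
      X (t + 1) ≤ (1 - 2 * α t * c₁) * X t + α t * c₂ * Y t + G * α t ^ 2) :
    X T ≤ x₀ * Real.exp (-(c₁ * e T)) + (G + ρ * c₂ * (H + 4)) / c₁ * α T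
      + 4 * c₂ * Real.exp (c₁ * M) * e T * Real.exp (-(min c₁ (2 * ρ) * e T)) := by
  set m := min c₁ (2 * ρ) with hm
  have hm0 : 0 ≤ m := le_min hc₁.le (by linarith)
  have hm1 : m ≤ c₁ := min_le_left _ _
  have hm2 : m ≤ 2 * ρ := min_le_right _ _
  have henn : ∀ t, τ ≤ t → 0 ≤ e t := by
    intro t ht
    induction t, ht using Nat.le_induction with
    | base => exact heτ.ge
    | succ t ht ih => linarith [he' t, hα (t + 1)]
  have hexp : ∀ {c : ℝ} (t : ℕ), 0 ≤ c →
      Real.exp (-(c * e t)) * Real.exp (-(c * α t)) ≤ Real.exp (-(c * e (t + 1))) := by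
    intro c t hc
    rw [← Real.exp_add, Real.exp_le_exp]
    nlinarith [he t]
  have hlin : ∀ v : ℝ, 1 - v ≤ Real.exp (-v) := fun v => by linarith [Real.add_one_le_exp (-v)]
  -- Of the contraction `2ρα`, one half absorbs the source `H(ρα)²` and the other the decrease of
  -- `α`, by `hα₂`.
  have hYb : ∀ t, τ ≤ t → t ≤ T → Y t ≤ 4 * Real.exp (-(2 * ρ * e t)) + H * ρ * α t := by
    intro t ht
    induction t, ht using Nat.le_induction with
    | base =>
      intro _
      rw [heτ]
      have : 0 ≤ H * ρ * α τ := mul_nonneg (mul_nonneg hH hρ) (hα τ)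
      simp only [mul_zero, neg_zero, Real.exp_zero]
      linarith
    | succ t ht ih =>
      intro htT
      have h1 := mul_le_mul_of_nonneg_left (ih (by omega)) (hb₂ t)
      have h2 := hY t ht (by omega)
      have h3 := hexp (c := 2 * ρ) t (by linarith)
      have h4 : Real.exp (-(2 * ρ * e t)) * (1 - 2 * (ρ * α t))
          ≤ Real.exp (-(2 * ρ * e t)) * Real.exp (-(2 * ρ * α t)) := by
        gcongr
        have := hlin (2 * ρ * α t)
        linarith
      have h5 := mul_le_mul_of_nonneg_left (hα₂ t) (mul_nonneg hH hρ)
      nlinarith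
  suffices h : ∀ t, τ ≤ t → t ≤ T → X t ≤ x₀ * Real.exp (-(c₁ * e t))
      + (G + ρ * c₂ * (H + 4)) / c₁ * α t
      + 4 * c₂ * Real.exp (c₁ * M) * e t * Real.exp (-(m * e t)) from h T hτT le_rfl
  -- `κc₁` is the sum of all sources of order `α²`: the noise `G`, the stationary part `H` of the
  -- `Y`-bound, and 4 from trading `α t` for an increment of `e`. One half of the contraction `2αc₁`
  -- pays for them, the other for the decrease of `α`.
  set κ := (G + ρ * c₂ * (H + 4)) / c₁ with hκ
  have hκ0 : 0 ≤ κ := by positivity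
  have hκ1 : κ * c₁ = G + ρ * c₂ * (H + 4) := div_mul_cancel₀ _ hc₁.ne'
  intro t ht
  induction t, ht using Nat.le_induction with
  | base =>
    intro _
    rw [heτ]
    have : 0 ≤ κ * α τ := mul_nonneg hκ0 (hα τ)
    simp only [mul_zero, neg_zero, Real.exp_zero]
    linarith
  | succ t ht ih =>
    intro htT
    have h1 := mul_le_mul_of_nonneg_left (ih (by omega)) (hb₁ t)
    have h2 := hX t ht (by omega)
    have h3 := mul_le_mul_of_nonneg_left (hYb t ht (by omega)) (mul_nonneg (hα t) hc₂)
    -- the exponential term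
    have h4 : (1 - 2 * α t * c₁) * (x₀ * Real.exp (-(c₁ * e t)))
        ≤ x₀ * Real.exp (-(c₁ * e (t + 1))) := by
      calc (1 - 2 * α t * c₁) * (x₀ * Real.exp (-(c₁ * e t)))
          ≤ Real.exp (-(c₁ * α t)) * (x₀ * Real.exp (-(c₁ * e t))) := by
            gcongr
            have := hlin (c₁ * α t)
            nlinarith [mul_nonneg (hα t) hc₁.le]
        _ = x₀ * (Real.exp (-(c₁ * e t)) * Real.exp (-(c₁ * α t))) := by ring
        _ ≤ _ := by gcongr; exact hexp t hc₁.le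
    -- the term of the order of the step size
    have h5 : (1 - 2 * α t * c₁) * (κ * α t) + G * α t ^ 2 + ρ * c₂ * (H + 4) * α t ^ 2
        ≤ κ * α (t + 1) := by
      have := mul_le_mul_of_nonneg_left (hα₁ t) hκ0
      have e1 : G * α t ^ 2 + ρ * c₂ * (H + 4) * α t ^ 2 = κ * c₁ * α t ^ 2 := by
        rw [hκ1]; ring
      nlinarith
    -- the mixed term
    set x := Real.exp (-(m * e t)) with hx
    have hx1 : x ≤ 1 := by
      rw [hx, Real.exp_le_one_iff]
      nlinarith [henn t ht]
    have hx0 : 0 < x := Real.exp_pos _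
    set E := Real.exp (c₁ * M)
    have hE0 : 0 < E := Real.exp_pos _
    have h6 : Real.exp (-(2 * ρ * e t)) ≤ x := by
      rw [hx, Real.exp_le_exp]
      nlinarith [henn t ht]
    have hmα := mul_le_mul_of_nonneg_right hm1 (hα t)
    have hcα := mul_nonneg hc₁.le (hα t)
    have h7 : 1 - 2 * α t * c₁ ≤ Real.exp (-(m * α t)) := by
      have := hlin (m * α t)
      linarith
    -- The source added at time `t` is not discounted over the current step; the factor `E` makes up
    -- for that.
    have h8 : 1 ≤ E * Real.exp (-(m * α t)) := by
      rw [← Real.exp_add, Real.one_le_exp_iff]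
      linarith [mul_le_mul_of_nonneg_left (hαM t) hc₁.le]
    have h9 : E * e t * x * (1 - 2 * α t * c₁) + (e (t + 1) - e t) * x
        ≤ E * e (t + 1) * Real.exp (-(m * e (t + 1))) := by
      have hd : 0 ≤ e (t + 1) - e t := by linarith [he' t, hα (t + 1)]
      calc _ ≤ E * e t * x * Real.exp (-(m * α t))
            + (e (t + 1) - e t) * x * (E * Real.exp (-(m * α t))) := by
            refine add_le_add ?_ ?_
            · exact mul_le_mul_of_nonneg_left h7
                (mul_nonneg (mul_nonneg hE0.le (henn t ht)) hx0.le)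
            · exact le_mul_of_one_le_right (mul_nonneg hd hx0.le) h8
        _ = E * e (t + 1) * (x * Real.exp (-(m * α t))) := by ring
        _ ≤ _ := mul_le_mul_of_nonneg_left (hexp t hm0)
            (mul_nonneg hE0.le (henn (t + 1) (by omega)))
    -- `e` grows by at least `α (t + 1) ≥ α t - ρ (α t)²`.
    have h10 : α t * x ≤ (e (t + 1) - e t) * x + ρ * α t ^ 2 := by
      have hd : α t - ρ * α t ^ 2 ≤ e (t + 1) - e t := by nlinarith [he' t, hα₂ t]
      have i1 := mul_le_mul_of_nonneg_right hd hx0.le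
      have i2 := mul_nonneg (mul_nonneg hρ (sq_nonneg (α t))) (sub_nonneg.2 hx1)
      linarith
    have h11 : (1 - 2 * α t * c₁) * (4 * c₂ * E * e t * x)
          + α t * c₂ * (4 * Real.exp (-(2 * ρ * e t)))
        ≤ 4 * c₂ * E * e (t + 1) * Real.exp (-(m * e (t + 1))) + 4 * ρ * c₂ * α t ^ 2 := by
      have i1 := mul_le_mul_of_nonneg_left h9 hc₂
      have i2 := mul_le_mul_of_nonneg_left h10 hc₂
      have i3 := mul_le_mul_of_nonneg_left h6 (mul_nonneg (hα t) hc₂)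
      linarith
    linarith

/-- The recursion with step sizes of order `1 / u`: contraction factor `1 - p / u` and
polynomially decaying forcing. -/
lemma rpow_mul_le_of_recursion {c₀ p r₁ r₂ E₁ E₂ : ℝ} (hτT : τ ≤ T) (hc₀ : 2 ≤ c₀)
    (hp : 0 ≤ p) (hr₁ : p < r₁) (hr₂ : p < r₂) (hE₁ : 0 ≤ E₁) (hE₂ : 0 ≤ E₂)
    (hX0 : ∀ t, 0 ≤ X t)
    (hX : ∀ t, τ ≤ t → t < T → X (t + 1) ≤ (1 - p / (t + c₀)) * X t
      + E₁ * ((t : ℝ) + c₀) ^ (-1 - r₁) + E₂ * ((t : ℝ) + c₀) ^ (-1 - r₂)) :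
    ((T : ℝ) + c₀) ^ p * X T ≤ ((τ : ℝ) + c₀) ^ p * X τ
      + 2 ^ p * (E₁ / (r₁ - p) + E₂ / (r₂ - p)) := by
  have hs₁ : 0 < r₁ - p := by linarith
  have hs₂ : 0 < r₂ - p := by linarith
  have hforce : ∀ {r E : ℝ} (t : ℕ), 0 < r - p → 0 ≤ E →
      ((t : ℝ) + c₀ + 1) ^ p * (E * ((t : ℝ) + c₀) ^ (-1 - r))
      ≤ 2 ^ p * (E / (r - p)) * (((t : ℝ) + c₀ - 1) ^ (-(r - p)) - ((t : ℝ) + c₀) ^ (-(r - p))) := by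
    intro r E t hs hE
    have ht : (0 : ℝ) ≤ t := t.cast_nonneg
    set u := (t : ℝ) + c₀
    have hu : 2 ≤ u := by simp only [u]; linarith
    have h1 := mul_rpow_neg_le (u := u) (by linarith) hs.le
    have h2 := add_one_rpow_le (u := u) (by linarith) hp
    have h3 : u ^ p * u ^ (-1 - r) = u ^ (-(r - p) - 1) := by
      rw [← Real.rpow_add (by linarith)]; congr 1; ring
    calc (u + 1) ^ p * (E * u ^ (-1 - r)) ≤ 2 ^ p * u ^ p * (E * u ^ (-1 - r)) := by gcongr
      _ = 2 ^ p * (E / (r - p)) * ((r - p) * u ^ (-(r - p) - 1)) := by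
          rw [← h3]; field_simp
      _ ≤ _ := by gcongr
  -- The telescoping remainders are kept so that the induction closes. The argument `t + c₀ - 1`
  -- comes from comparing `u` with `u - 1` in `mul_rpow_neg_le`, and is at least 1 as `c₀ ≥ 2`.
  suffices h : ∀ t, τ ≤ t → t ≤ T → ((t : ℝ) + c₀) ^ p * X t ≤ ((τ : ℝ) + c₀) ^ p * X τ
      + 2 ^ p * (E₁ / (r₁ - p)) * (1 - ((t : ℝ) + c₀ - 1) ^ (-(r₁ - p)))
      + 2 ^ p * (E₂ / (r₂ - p)) * (1 - ((t : ℝ) + c₀ - 1) ^ (-(r₂ - p))) by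
    refine (h T hτT le_rfl).trans ?_
    have hT : (0 : ℝ) ≤ (T : ℝ) + c₀ - 1 := by linarith [(T.cast_nonneg : (0 : ℝ) ≤ T)]
    have i1 : 0 ≤ 2 ^ p * (E₁ / (r₁ - p)) * ((T : ℝ) + c₀ - 1) ^ (-(r₁ - p)) := by positivity
    have i2 : 0 ≤ 2 ^ p * (E₂ / (r₂ - p)) * ((T : ℝ) + c₀ - 1) ^ (-(r₂ - p)) := by positivity
    linarith
  intro t ht
  induction t, ht using Nat.le_induction with
  | base =>
    intro _
    have hτ : (1 : ℝ) ≤ (τ : ℝ) + c₀ - 1 := by linarith [(τ.cast_nonneg : (0 : ℝ) ≤ τ)]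
    have j1 := Real.rpow_le_one_of_one_le_of_nonpos hτ (neg_nonpos.2 hs₁.le)
    have j2 := Real.rpow_le_one_of_one_le_of_nonpos hτ (neg_nonpos.2 hs₂.le)
    have i1 : 0 ≤ 2 ^ p * (E₁ / (r₁ - p)) * (1 - ((τ : ℝ) + c₀ - 1) ^ (-(r₁ - p))) :=
      mul_nonneg (by positivity) (by linarith)
    have i2 : 0 ≤ 2 ^ p * (E₂ / (r₂ - p)) * (1 - ((τ : ℝ) + c₀ - 1) ^ (-(r₂ - p))) :=
      mul_nonneg (by positivity) (by linarith)
    linarith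
  | succ t ht ih =>
    intro htT
    have hu : (0 : ℝ) < (t : ℝ) + c₀ := by positivity
    have h1 := ih (by omega)
    have h2 := hX t ht (by omega)
    have f1 := hforce (r := r₁) t hs₁ hE₁
    have f2 := hforce (r := r₂) t hs₂ hE₂
    have h3 := mul_le_mul_of_nonneg_right
      (one_sub_div_mul_add_one_rpow_le hu hp) (hX0 t)
    have h4 := mul_le_mul_of_nonneg_left h2
      (show 0 ≤ ((t : ℝ) + c₀ + 1) ^ p by positivity)
    have e1 : ((t + 1 : ℕ) : ℝ) + c₀ = (t : ℝ) + c₀ + 1 := by push_cast; ring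
    rw [e1, add_sub_cancel_right]
    linarith

end Recursions
section Recursions

variable {τ T : ℕ} {Y : ℕ → ℝ} {c₀ E : ℝ}

/-- The recursion with contraction factor `1 - 1 / u`, where a logarithm appears. -/
lemma mul_le_add_log_of_recursion (hτT : τ ≤ T) (hc₀ : 2 ≤ c₀) (hE : 0 ≤ E)
    (hY0 : ∀ t, 0 ≤ Y t)
    (hY : ∀ t, τ ≤ t → t < T →
      Y (t + 1) ≤ (1 - 1 / (t + c₀)) * Y t + E / ((t : ℝ) + c₀) ^ 2) :
    ((T : ℝ) + c₀) * Y T ≤ ((τ : ℝ) + c₀) * Y τ + 2 * E * Real.log (T + c₀) := by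
  suffices h : ∀ t, τ ≤ t → t ≤ T →
      ((t : ℝ) + c₀) * Y t ≤ ((τ : ℝ) + c₀) * Y τ + 2 * E * Real.log (t + c₀ - 1) by
    refine (h T hτT le_rfl).trans ?_
    have hT : (0 : ℝ) ≤ T := T.cast_nonneg
    gcongr
    · linarith
    · linarith
  intro t ht
  induction t, ht using Nat.le_induction with
  | base =>
    intro _
    have hτ : (0 : ℝ) ≤ τ := τ.cast_nonneg
    have : 0 ≤ 2 * E * Real.log (τ + c₀ - 1) :=
      mul_nonneg (by linarith) (Real.log_nonneg (by linarith))
    linarith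
  | succ t ht ih =>
    intro htT
    have ht0 : (0 : ℝ) ≤ t := t.cast_nonneg
    have h1 := ih (by omega)
    have h2 := hY t ht (by omega)
    have e1 : ((t + 1 : ℕ) : ℝ) + c₀ = (t : ℝ) + c₀ + 1 := by push_cast; ring
    rw [e1, add_sub_cancel_right]
    set u := (t : ℝ) + c₀
    have hu : 2 ≤ u := by simp only [u]; linarith
    have hu0 : 0 < u := by linarith
    have h3 := one_div_le_log_sub_log (u := u) (by linarith)
    have h4 := mul_le_mul_of_nonneg_left h2 (show 0 ≤ u + 1 by linarith)
    have h5 : (u + 1) * ((1 - 1 / u) * Y t) ≤ u * Y t := by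
      rw [← mul_assoc]
      refine mul_le_mul_of_nonneg_right ?_ (hY0 t)
      have : (u + 1) * (1 - 1 / u) = u - 1 / u := by field_simp; ring
      rw [this]
      linarith [show 0 < 1 / u by positivity]
    have h6 : (u + 1) * (E / u ^ 2) ≤ 2 * E * (1 / u) := by
      calc (u + 1) * (E / u ^ 2) ≤ (2 * u) * (E / u ^ 2) := by gcongr; linarith
        _ = 2 * E * (1 / u) := by field_simp
    have h7 := mul_le_mul_of_nonneg_left h3 (show 0 ≤ 2 * E by linarith)
    linarith

/-- The recursion with contraction factor `1 - q / u` for `q > 1`. -/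
lemma le_div_of_recursion {q V : ℝ} (hτT : τ ≤ T) (hc₀ : 2 ≤ c₀) (hV : 0 ≤ V)
    (hq : ∀ t : ℕ, 0 ≤ 1 - q / (t + c₀)) (hEV : E ≤ (q - 1) * V)
    (hτ : Y τ ≤ V / (τ + c₀))
    (hY : ∀ t, τ ≤ t → t < T →
      Y (t + 1) ≤ (1 - q / (t + c₀)) * Y t + E / ((t : ℝ) + c₀) ^ 2) :
    Y T ≤ V / (T + c₀) := by
  suffices h : ∀ t, τ ≤ t → t ≤ T → Y t ≤ V / (t + c₀) from h T hτT le_rfl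
  intro t ht
  induction t, ht using Nat.le_induction with
  | base => exact fun _ => hτ
  | succ t ht ih =>
    intro htT
    have ht0 : (0 : ℝ) ≤ t := t.cast_nonneg
    have h1 := mul_le_mul_of_nonneg_left (ih (by omega)) (hq t)
    have h2 := hY t ht (by omega)
    have e1 : ((t + 1 : ℕ) : ℝ) + c₀ = (t : ℝ) + c₀ + 1 := by push_cast; ring
    rw [e1]
    set u := (t : ℝ) + c₀
    have hu0 : 0 < u := by simp only [u]; linarith
    have h3 : E / u ^ 2 ≤ (q - 1) * V / u ^ 2 := by gcongr
    have h4 : V / u - V / u ^ 2 ≤ V / (u + 1) := by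
      have : V / (u + 1) - (V / u - V / u ^ 2) = V / (u ^ 2 * (u + 1)) := by
        field_simp; ring
      linarith [show 0 ≤ V / (u ^ 2 * (u + 1)) by positivity]
    have h5 : (1 - q / u) * (V / u) + (q - 1) * V / u ^ 2 = V / u - V / u ^ 2 := by
      field_simp; ring
    linarith

end Recursions

/-! ### The threshold for `c₀` and the choice of the lag. -/

lemma le_natCast_add (c : ℝ) (t : ℕ) : c ≤ (t : ℝ) + c := by
  linarith [(t.cast_nonneg : (0 : ℝ) ≤ t)]

/-- Requirements on the shift `c₀` of the step sizes. -/
structure IsThreshold (a ρ₀ ξ C b c : ℝ) : Prop where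
  two_le : 2 ≤ c
  step_le : ∀ u, c ≤ u → a / u ^ ξ ≤ 1 / 6
  le : a ≤ c
  lag_le : ∀ u, c ≤ u → L₁ C b * (1 + ξ * Real.log u - Real.log (ρ₀ * a)) ≤ u / 2

/-- All requirements hold eventually, since `u^ξ → ∞` and `log u = o(u)`. Only `a, ρ₀, ξ, C, b`
enter, so the threshold is uniform over all problems with these parameters. -/
lemma exists_isThreshold {a ρ₀ ξ C b : ℝ} (hξ : 0 < ξ) :
    ∃ c, IsThreshold a ρ₀ ξ C b c := by
  have h1 : ∀ᶠ u : ℝ in Filter.atTop, a / u ^ ξ ≤ 1 / 6 :=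
    ((tendsto_rpow_atTop hξ).const_div_atTop a).eventually (ge_mem_nhds (by norm_num))
  have h2 : ∀ᶠ u : ℝ in Filter.atTop,
      L₁ C b * (1 + ξ * Real.log u - Real.log (ρ₀ * a)) ≤ u / 2 := by
    have o1 : (fun u : ℝ => L₁ C b * ξ * Real.log u) =o[Filter.atTop] (id : ℝ → ℝ) :=
      Real.isLittleO_log_id_atTop.const_mul_left _
    have o2 : (fun _ : ℝ => L₁ C b * (1 - Real.log (ρ₀ * a))) =o[Filter.atTop] (id : ℝ → ℝ) :=
      Asymptotics.isLittleO_const_id_atTop _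
    filter_upwards [(o1.add o2).def (show (0 : ℝ) < 1 / 2 by norm_num),
      Filter.eventually_ge_atTop 0] with u hu hu0
    rw [Real.norm_eq_abs, id, Real.norm_of_nonneg hu0] at hu
    linarith [le_abs_self (L₁ C b * ξ * Real.log u + L₁ C b * (1 - Real.log (ρ₀ * a)))]
  obtain ⟨c, hc⟩ := Filter.eventually_atTop.1 (h1.and h2)
  refine ⟨max c (max 2 a), ?_, fun u hu => (hc u ?_).1, ?_, fun u hu => (hc u ?_).2⟩
  · exact (le_max_left 2 a).trans (le_max_right _ _)
  · exact (le_max_left _ _).trans hu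
  · exact (le_max_right 2 a).trans (le_max_right _ _)
  · exact (le_max_left _ _).trans hu

namespace IsThreshold

variable {a ρ₀ ξ C b c₀ : ℝ}

lemma mono {c : ℝ} (h : IsThreshold a ρ₀ ξ C b c) (hc : c ≤ c₀) : IsThreshold a ρ₀ ξ C b c₀ :=
  ⟨h.two_le.trans hc, fun u hu => h.step_le u (hc.trans hu), h.le.trans hc,
    fun u hu => h.lag_le u (hc.trans hu)⟩

variable (h : IsThreshold a ρ₀ ξ C b c₀) (ha : 0 < a)

include h

lemma shift_pos (t : ℕ) : 0 < (t : ℝ) + c₀ := by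
  linarith [h.two_le, (t.cast_nonneg : (0 : ℝ) ≤ t)]

lemma one_le_shift (t : ℕ) : 1 ≤ (t : ℝ) + c₀ := by linarith [le_natCast_add c₀ t, h.two_le]

lemma step_le' (t : ℕ) : step a c₀ ξ t ≤ 1 / 6 := h.step_le _ (le_natCast_add c₀ t)

include ha

lemma step_pos (t : ℕ) : 0 < step a c₀ ξ t :=
  div_pos ha (Real.rpow_pos_of_pos (h.shift_pos t) _)

lemma step_antitone (hξ : 0 < ξ) : Antitone (step a c₀ ξ) := by
  intro i j hij
  unfold step
  have := h.shift_pos i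
  gcongr

lemma log_shift_sub_nonneg (hρ : 0 < ρ₀) (hρ1 : ρ₀ ≤ 1) (T : ℕ) :
    0 ≤ Real.log ((T : ℝ) + c₀) - Real.log (ρ₀ * a) := by
  rw [sub_nonneg]
  apply Real.log_le_log (by positivity)
  have := mul_le_of_le_one_left ha.le hρ1
  linarith [h.le, le_natCast_add c₀ T]

/-- The lag is at most half of the current shifted time, so shifted times differ by a factor at most
2 and step sizes by at most `2^ξ ≤ 2`. -/
lemma step_le_two_mul (hξ : 0 < ξ) (hξ1 : ξ ≤ 1) {n k : ℕ}
    (hk : (k : ℝ) ≤ (((n + k : ℕ) : ℝ) + c₀) / 2) :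
    step a c₀ ξ n ≤ 2 * step a c₀ ξ (n + k) := by
  unfold step
  have h1 := h.shift_pos n
  have h2 := h.shift_pos (n + k)
  have h3 : (((n + k : ℕ) : ℝ) + c₀) ^ ξ ≤ 2 * ((n : ℝ) + c₀) ^ ξ := by
    calc (((n + k : ℕ) : ℝ) + c₀) ^ ξ ≤ (2 * ((n : ℝ) + c₀)) ^ ξ := by
          push_cast at hk ⊢
          have hk0 : (0 : ℝ) ≤ k := k.cast_nonneg
          apply Real.rpow_le_rpow <;> linarith
      _ = 2 ^ ξ * ((n : ℝ) + c₀) ^ ξ := Real.mul_rpow (by norm_num) h1.le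
      _ ≤ 2 ^ (1 : ℝ) * ((n : ℝ) + c₀) ^ ξ := by gcongr; norm_num
      _ = _ := by rw [Real.rpow_one]
  rw [← mul_div_assoc, div_le_div_iff₀ (by positivity) (by positivity)]
  nlinarith

/-- A lag after which the chain has mixed to the precision `c α_t`, and which is short enough for
the step sizes not to vary by more than a factor of two. -/
lemma exists_lag {S : Type*} [Fintype S] [DecidableEq S] {P : Matrix S S ℝ} {μ : S → ℝ}
    (hmix : ∀ (k : ℕ) (s : S), mixDist P μ k s ≤ C * b ^ k) (hC : 1 < C) (hb0 : 0 ≤ b)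
    (hb1 : b < 1) (hξ : 0 < ξ) (hξ1 : ξ ≤ 1) (hρ : 0 < ρ₀) {c : ℝ} (hρc : ρ₀ ≤ c)
    (hc1 : c ≤ 1) {τ t T : ℕ} (hτ : mixingTime P μ (ρ₀ * step a c₀ ξ T) ≤ τ) (hτt : τ ≤ t)
    (htT : t ≤ T) :
    ∃ n k, n + k = t ∧ step a c₀ ξ n ≤ 2 * step a c₀ ξ (n + k) ∧
      (∀ y, mixDist P μ k y ≤ c * step a c₀ ξ (n + k)) ∧
      (k : ℝ) ≤ L₁ C b * (Real.log (T + c₀) - Real.log (c * a) + 1) := by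
  have hc : 0 < c := hρ.trans_le hρc
  have hstep := h.step_pos ha t
  have hsmall : ∀ {x : ℝ} (i : ℕ), x ≤ 1 → x * step a c₀ ξ i ≤ Real.exp (-1) := by
    intro x i hx
    have h1 := mul_le_mul_of_nonneg_right hx (h.step_pos ha i).le
    linarith [h.step_le' i, Real.exp_neg_one_gt_d9]
  have hε : 0 < c * step a c₀ ξ t := by positivity
  -- The precision `c α_t` is no finer than `ρ₀ α_T`, so the lag is at most `τ ≤ t` and never
  -- reaches before time 0.
  have hkt : mixingTime P μ (c * step a c₀ ξ t) ≤ t := by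
    refine ((mixingTime_anti hmix hC hb0 hb1 (mul_pos hρ (h.step_pos ha T))
      (hsmall T (hρc.trans hc1)) ?_).trans hτ).trans hτt
    exact mul_le_mul hρc (h.step_antitone ha hξ htT) (h.step_pos ha T).le hc.le
  have hk := mixingTime_le hmix hC hb0 hb1 hε (hsmall t hc1)
  have hD := mixDist_mixingTime_le hmix hC hb0 hb1 hε (hsmall t hc1)
  set k := mixingTime P μ (c * step a c₀ ξ t)
  obtain ⟨n, hn⟩ := Nat.exists_eq_add_of_le' hkt
  have hlog : Real.log (c * step a c₀ ξ t)
      = Real.log (c * a) - ξ * Real.log ((t : ℝ) + c₀) := by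
    have h1 := h.shift_pos t
    rw [step, ← mul_div_assoc, Real.log_div (by positivity) (by positivity),
      Real.log_rpow (h.shift_pos t)]
  have hL := one_le_L₁ C b
  rw [hlog] at hk
  refine ⟨n, k, hn.symm, h.step_le_two_mul ha hξ hξ1 ?_, ?_, ?_⟩
  · rw [← hn]
    refine hk.trans (le_trans ?_ (h.lag_le _ (le_natCast_add c₀ t)))
    have h1 : Real.log (ρ₀ * a) ≤ Real.log (c * a) := Real.log_le_log (by positivity) (by gcongr)
    refine mul_le_mul_of_nonneg_left ?_ (by linarith)
    linarith
  · rw [← hn]; exact hD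
  · refine hk.trans (mul_le_mul_of_nonneg_left ?_ (by linarith))
    have h1 : 0 ≤ Real.log ((t : ℝ) + c₀) := Real.log_nonneg (h.one_le_shift t)
    have h2 : Real.log ((t : ℝ) + c₀) ≤ Real.log ((T : ℝ) + c₀) := by
      have h3 : (t : ℝ) ≤ T := by exact_mod_cast htT
      exact Real.log_le_log (h.shift_pos t) (by linarith)
    nlinarith

end IsThreshold

/-! ### From the algorithm to the scalar recursions. -/

/-- The one-step inequalities for the mean squared errors `X` of `θ` and `Y` of `w` along the
single-chain algorithm, from time `τ` up to time `T`. -/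
structure ErrorRecursion (α X Y : ℕ → ℝ) (ρ₀ Rθ c1 c2 G1 G2 : ℝ) (τ T : ℕ) : Prop where
  nonneg_X : ∀ t, 0 ≤ X t
  nonneg_Y : ∀ t, 0 ≤ Y t
  X_le : ∀ t, X t ≤ 4 * Rθ ^ 2
  Y_le : ∀ t, Y t ≤ 4
  succ_X : ∀ t, τ ≤ t → t < T →
    X (t + 1) ≤ (1 - 2 * α t * c1) * X t + α t * c2 * Y t + G1 * α t ^ 2
  succ_Y : ∀ t, τ ≤ t → t < T →
    Y (t + 1) ≤ (1 - 2 * (ρ₀ * α t)) * Y t + (G2 - 4) * (ρ₀ * α t) ^ 2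

section Constants

variable {a ρ₀ ξ C b c₀ rmax Rθ : ℝ} (hth : IsThreshold a ρ₀ ξ C b c₀) (ha : 0 < a)
  (hρ : 0 < ρ₀) (hρ1 : ρ₀ ≤ 1)

include hth ha hρ hρ1

lemma log_sub_log_nonneg (T : ℕ) : 0 ≤ Real.log ((T : ℝ) + c₀) - Real.log a := by
  have := hth.log_shift_sub_nonneg ha hρ hρ1 T
  have h1 : Real.log (ρ₀ * a) ≤ Real.log a :=
    Real.log_le_log (by positivity) (mul_le_of_le_one_left ha.le hρ1)
  have := le_natCast_add c₀ T
  rw [sub_nonneg]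
  exact Real.log_le_log ha (by linarith [hth.le])

lemma four_le_G₂ (T : ℕ) : 4 ≤ G₂ a c₀ ρ₀ C b T := by
  have h1 := hth.log_shift_sub_nonneg ha hρ hρ1 T
  have h2 := one_le_L₁ C b
  unfold G₂
  have : 0 ≤ L₁ C b * (Real.log ((T : ℝ) + c₀) - Real.log (ρ₀ * a) + 1) := by
    apply mul_nonneg <;> linarith
  linarith

lemma G₁_nonneg (T : ℕ) : 0 ≤ G₁ a c₀ ρ₀ C b rmax Rθ T := by
  have h1 := log_sub_log_nonneg hth ha hρ hρ1 T
  have h2 := one_le_L₁ C b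
  unfold G₁
  have : 0 ≤ (28 + 8 * ρ₀) * (L₁ C b * (Real.log ((T : ℝ) + c₀) - Real.log a + 1)) := by
    apply mul_nonneg (by positivity); apply mul_nonneg <;> linarith
  refine mul_nonneg ?_ (sq_nonneg _)
  linarith

end Constants

/-- The lag is taken at precision `α_t` for the `θ`-noise and `ρ₀α_t` for the `w`-noise, hence `log
a` in `G₁` and `log (ρ₀a)` in `G₂`. As the logarithmic factor is at least 1, it also absorbs the
additive constants. -/
lemma errorRecursion {a ρ₀ ξ C b c₀ : ℝ} (hth : IsThreshold a ρ₀ ξ C b c₀) (ha : 0 < a)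
    (hρ : 0 < ρ₀) (hρ1 : ρ₀ ≤ 1) (hξ : 0 < ξ) (hξ1 : ξ ≤ 1) (hC : 1 < C) (hb0 : 0 ≤ b)
    (hb1 : b < 1) {S A : Type*} [Fintype S] [DecidableEq S] [Fintype A] {d : ℕ}
    {m : Model S A d} {μ : S → ℝ} {θstar w₀ θ₀ : EuclideanSpace ℝ (Fin d)} {Rw Rθ lam : ℝ}
    (hμ : IsStationaryDist m.P μ)
    (hmix : ∀ (k : ℕ) (s : S), mixDist m.P μ k s ≤ C * b ^ k) (hfix : m.IsFixedPoint μ θstar)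
    (hθ : ‖θstar‖ ≤ Rθ) (hlam : 0 < lam)
    (hrun : m.IsRun ρ₀ (step a c₀ ξ) Rw Rθ w₀ θ₀)
    {Ω : Type*} [MeasurableSpace Ω] {ℙ : Measure Ω} [IsProbabilityMeasure ℙ]
    {s : ℕ → Ω → S} (hs : IsMarkovChain m.P ℙ s) {τ T : ℕ}
    (hτ : mixingTime m.P μ (ρ₀ * step a c₀ ξ T) ≤ τ) :
    ErrorRecursion (step a c₀ ξ)
      (fun t => ∫ ω, ‖(m.iterates (step a c₀ ξ) (fun t => ρ₀ * step a c₀ ξ t) Rw Rθ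
        w₀ θ₀ (fun t => s t ω) t).2 - θstar‖ ^ 2 ∂ℙ)
      (fun t => ∫ ω, ‖(m.iterates (step a c₀ ξ) (fun t => ρ₀ * step a c₀ ξ t) Rw Rθ
        w₀ θ₀ (fun t => s t ω) t).1 - m.wStar μ‖ ^ 2 ∂ℙ)
      ρ₀ Rθ (c₁ (m.eta μ) m.rMax Rθ lam) (c₂ m.rMax Rθ lam)
      (G₁ a c₀ ρ₀ C b m.rMax Rθ T) (G₂ a c₀ ρ₀ C b T) τ T where
  nonneg_X t := integral_nonneg fun _ => sq_nonneg _
  nonneg_Y t := integral_nonneg fun _ => sq_nonneg _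
  X_le := hrun.integral_snd_le hs hθ
  Y_le := hrun.integral_fst_le hμ hs
  succ_X t hτt htT := by
    obtain ⟨n, k, rfl, hα, hD, hk⟩ := hth.exists_lag ha hmix hC hb0 hb1 hξ hξ1 hρ (c := 1)
      hρ1 le_rfl hτ hτt htT.le
    refine (hrun.integral_snd_succ_le hμ hs hfix hθ hlam n k hα (by simpa using hD)).trans ?_
    gcongr
    rw [G₁]
    refine mul_le_mul_of_nonneg_right ?_ (sq_nonneg _)
    rw [one_mul] at hk
    have h1 := log_sub_log_nonneg hth ha hρ hρ1 T
    have h2 := one_le_L₁ C b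
    set l := L₁ C b * (Real.log (T + c₀) - Real.log a + 1) with hl
    have h3 : 1 ≤ l := by rw [hl]; nlinarith
    have e : 4 * (28 + 8 * ρ₀) * L₁ C b * (Real.log (T + c₀) - Real.log a + 1)
        = (112 + 32 * ρ₀) * l := by rw [hl]; ring
    rw [e]
    have h4 : (48 + 32 * ρ₀) * k ≤ (48 + 32 * ρ₀) * l := by gcongr
    linarith
  succ_Y t hτt htT := by
    obtain ⟨n, k, rfl, hα, hD, hk⟩ := hth.exists_lag ha hmix hC hb0 hb1 hξ hξ1 hρ (c := ρ₀)
      le_rfl hρ1 hτ hτt htT.le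
    refine (hrun.integral_fst_succ_le hμ hs n k hα hD).trans ?_
    gcongr
    rw [G₂]
    have h1 := hth.log_shift_sub_nonneg ha hρ hρ1 T
    have h2 := one_le_L₁ C b
    set l := L₁ C b * (Real.log (T + c₀) - Real.log (ρ₀ * a) + 1) with hl
    have h3 : 1 ≤ l := by rw [hl]; nlinarith
    linarith

/-! ### The error bounds for `ξ < 1` and `ξ = 1`. -/

namespace ErrorRecursion

variable {a ρ₀ ξ C b c₀ Rθ c1 c2 G1 G2 : ℝ} {X Y : ℕ → ℝ} {τ T : ℕ}

/-- The error bound for step sizes `a / (t + c₀) ^ ξ` with `ξ < 1`. -/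
theorem le_of_lt_one (h : ErrorRecursion (step a c₀ ξ) X Y ρ₀ Rθ c1 c2 G1 G2 τ T)
    (hth : IsThreshold a ρ₀ ξ C b c₀) (ha : 0 < a) (hρ : 0 < ρ₀) (hρ1 : ρ₀ ≤ 1)
    (hξ : 0 < ξ) (hξ1 : ξ < 1) (hτT : τ ≤ T) (hc1 : 0 < c1) (hc1' : c1 ≤ 3) (hc2 : 0 ≤ c2)
    (hG1 : 0 ≤ G1) (hG2 : 4 ≤ G2)
    (hc₀ : max ((ξ / (a * c1)) ^ (1 / (1 - ξ))) ((ξ / (ρ₀ * a)) ^ (1 / (1 - ξ))) ≤ c₀) :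
    X T ≤ 4 * Rθ ^ 2 * Real.exp (-(a * c1 / (1 - ξ)) * Δ c₀ ξ τ T)
      + a * (G1 + ρ₀ * c2 * G2) / (c1 * ((T : ℝ) + c₀) ^ ξ)
      + 4 * a * c2 / (1 - ξ) * Real.exp (a * c1 / c₀ ^ ξ) * Δ c₀ ξ τ T
          * Real.exp (-(a / (1 - ξ)) * min c1 (2 * ρ₀) * Δ c₀ ξ τ T) := by
  have hξ' : 0 < 1 - ξ := by linarith
  have hc₀0 : 0 < c₀ := by linarith [hth.two_le]
  have hcast : ∀ t : ℕ, ((t + 1 : ℕ) : ℝ) + c₀ = (t : ℝ) + c₀ + 1 := fun t => by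
    push_cast; ring
  -- The lower bound on `c₀` says `ξ / u ≤ c a / u^ξ` for all `u ≥ c₀`: the relative decrease of the
  -- step size is at most `c α`. It is needed for `c = c1` and `c = ρ₀`.
  have hstep : ∀ {c : ℝ}, 0 < c → (ξ / (a * c)) ^ (1 / (1 - ξ)) ≤ c₀ →
      ∀ t, step a c₀ ξ t * (1 - c * step a c₀ ξ t) ≤ step a c₀ ξ (t + 1) := by
    intro c hc hcc t
    have hu := hth.shift_pos t
    have h1 := div_rpow_mul_le (hth.one_le_shift t) hξ.le hξ1.le ha.le
    have h2 : ξ / (a * c) ≤ ((t : ℝ) + c₀) ^ (1 - ξ) := by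
      calc ξ / (a * c) = ((ξ / (a * c)) ^ (1 / (1 - ξ))) ^ (1 - ξ) := by
            rw [← Real.rpow_mul (by positivity), one_div_mul_cancel hξ'.ne', Real.rpow_one]
        _ ≤ ((t : ℝ) + c₀) ^ (1 - ξ) := by
            apply Real.rpow_le_rpow (by positivity) _ hξ'.le
            linarith [le_natCast_add c₀ t]
    rw [Real.rpow_sub hu, Real.rpow_one, div_le_div_iff₀ (by positivity) (by positivity)] at h2
    have h3 : ξ / ((t : ℝ) + c₀) ≤ c * step a c₀ ξ t := by
      rw [step, ← mul_div_assoc, div_le_div_iff₀ hu (by positivity)]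
      linarith
    refine le_trans ?_ (h1.trans (le_of_eq ?_))
    · exact mul_le_mul_of_nonneg_left (by linarith) (hth.step_pos ha t).le
    · rw [step, hcast]
  have hsub : ∀ t : ℕ, a / (1 - ξ) * (((t : ℝ) + c₀ + 1) ^ (1 - ξ) - ((t : ℝ) + c₀) ^ (1 - ξ))
      ≤ step a c₀ ξ t := by
    intro t
    calc _ ≤ a / (1 - ξ) * ((1 - ξ) / ((t : ℝ) + c₀) ^ ξ) := by
          gcongr; exact add_one_rpow_sub_le (hth.one_le_shift t) hξ.le hξ1.le
      _ = _ := by rw [step]; field_simp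
  have hsub' : ∀ t : ℕ, step a c₀ ξ (t + 1)
      ≤ a / (1 - ξ) * (((t : ℝ) + c₀ + 1) ^ (1 - ξ) - ((t : ℝ) + c₀) ^ (1 - ξ)) := by
    intro t
    calc step a c₀ ξ (t + 1) = a / (1 - ξ) * ((1 - ξ) / ((t : ℝ) + c₀ + 1) ^ ξ) := by
          rw [step, hcast]; field_simp
      _ ≤ _ := by gcongr; exact le_add_one_rpow_sub (hth.one_le_shift t) hξ.le hξ1.le
  -- With `H = G2 - 4`, the constant `H + 4` of `le_of_twoTimescale` is exactly `G2`.
  have key := le_of_twoTimescale (α := step a c₀ ξ) (M := a / c₀ ^ ξ) (H := G2 - 4)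
    (e := fun t => a / (1 - ξ) * (((t : ℝ) + c₀) ^ (1 - ξ) - ((τ : ℝ) + c₀) ^ (1 - ξ)))
    hτT (fun t => (hth.step_pos ha t).le)
    (fun t => by
      rw [step]
      have := le_natCast_add c₀ t
      gcongr)
    (by simp)
    (fun t => by rw [hcast]; linarith [hsub t])
    (fun t => by rw [hcast]; linarith [hsub' t])
    hc1 hc2 hρ.le (by linarith) (by positivity)
    (hstep hc1 ((le_max_left _ _).trans hc₀))
    (hstep hρ (by rw [mul_comm a]; exact (le_max_right _ _).trans hc₀))
    (fun t => by nlinarith [hth.step_le' t, hth.step_pos ha t])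
    (fun t => by nlinarith [hth.step_le' t, hth.step_pos ha t])
    hG1 (h.X_le τ) (h.Y_le τ) h.succ_Y h.succ_X
  refine key.trans (le_of_eq ?_)
  rw [sub_add_cancel]
  simp only [Δ, step]
  congr 1
  · congr 1
    · congr 2; ring
    · field_simp
  · rw [show c1 * (a / c₀ ^ ξ) = a * c1 / c₀ ^ ξ by ring]
    rw [show -(min c1 (2 * ρ₀) * (a / (1 - ξ) * (((T : ℝ) + c₀) ^ (1 - ξ)
        - ((τ : ℝ) + c₀) ^ (1 - ξ))))
      = -(a / (1 - ξ)) * min c1 (2 * ρ₀) * (((T : ℝ) + c₀) ^ (1 - ξ)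
        - ((τ : ℝ) + c₀) ^ (1 - ξ)) by ring]
    ring

/-- Half of the contraction `2ac₁/u` is discarded. The rate `ac₁` that remains will be below 1, so
the noise of order `u⁻²` stays summable after multiplication by `u^(ac₁)`. -/
lemma succ_X_one (h : ErrorRecursion (step a c₀ 1) X Y ρ₀ Rθ c1 c2 G1 G2 τ T)
    (hth : IsThreshold a ρ₀ 1 C b c₀) (ha : 0 < a) (hc1 : 0 ≤ c1) (hc2 : 0 ≤ c2)
    {V r : ℝ} (hV : ∀ t, τ ≤ t → t ≤ T → Y t ≤ V * ((t : ℝ) + c₀) ^ (-r))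
    (t : ℕ) (hτt : τ ≤ t) (htT : t < T) :
    X (t + 1) ≤ (1 - a * c1 / (t + c₀)) * X t
      + a * c2 * V * ((t : ℝ) + c₀) ^ (-1 - r) + a ^ 2 * G1 * ((t : ℝ) + c₀) ^ (-1 - (1 : ℝ)) := by
  have h1 := h.succ_X t hτt htT
  have h2 := hV t hτt htT.le
  have hu := hth.shift_pos t
  have hX := h.nonneg_X t
  have e0 : ((t : ℝ) + c₀) ^ (-1 - r) = ((t : ℝ) + c₀) ^ (-r) / ((t : ℝ) + c₀) := by
    rw [← Real.rpow_sub_one hu.ne']; congr 1; ring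
  have e1 : ((t : ℝ) + c₀) ^ (-1 - (1 : ℝ)) = 1 / ((t : ℝ) + c₀) ^ 2 := by
    rw [show (-1 - (1 : ℝ)) = -((2 : ℕ) : ℝ) by norm_num, Real.rpow_neg hu.le, Real.rpow_natCast,
      one_div]
  simp only [step, Real.rpow_one] at h1
  rw [e0, e1]
  set u := (t : ℝ) + c₀
  have h3 : a / u * c2 * Y t ≤ a / u * c2 * (V * u ^ (-r)) := by gcongr
  have h4 : 0 ≤ a / u * c1 * X t := by positivity
  have e2 : (1 - a * c1 / u) * X t + a * c2 * V * (u ^ (-r) / u) + a ^ 2 * G1 * (1 / u ^ 2)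
      = (1 - 2 * (a / u) * c1) * X t + a / u * c2 * (V * u ^ (-r)) + G1 * (a / u) ^ 2
        + a / u * c1 * X t := by
    field_simp; ring
  rw [e2]
  linarith

/-- The error bound for step sizes `a / (t + c₀)`, given a decay rate of the error of `w`. -/
lemma le_of_one_of_decay (h : ErrorRecursion (step a c₀ 1) X Y ρ₀ Rθ c1 c2 G1 G2 τ T)
    (hth : IsThreshold a ρ₀ 1 C b c₀) (ha : 0 < a) (hτT : τ ≤ T) (hc1 : 0 ≤ c1)
    (hac1 : a * c1 < 1) (hc2 : 0 ≤ c2) (hG1 : 0 ≤ G1) {V r Γ : ℝ} (hV0 : 0 ≤ V)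
    (hr : a * c1 < r)
    (hV : ∀ t, τ ≤ t → t ≤ T → Y t ≤ V * ((t : ℝ) + c₀) ^ (-r))
    (hΓ : 2 ^ (a * c1) * (a * c2 * V / (r - a * c1)) ≤ Γ) :
    X T ≤ 4 * Rθ ^ 2 * (((τ : ℝ) + c₀) / ((T : ℝ) + c₀)) ^ (a * c1)
      + (Γ + Γ₀ a c1 * G1) / ((T : ℝ) + c₀) ^ (a * c1) := by
  have hp : 0 ≤ a * c1 := by positivity
  have huT := hth.shift_pos T
  have huτ := hth.shift_pos τ
  have h1 := rpow_mul_le_of_recursion (X := X) hτT hth.two_le hp hr hac1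
    (by positivity) (by positivity) h.nonneg_X (h.succ_X_one hth ha hc1 hc2 hV)
  have h2 : (2 : ℝ) ^ (a * c1) * (a ^ 2 * G1 / (1 - a * c1)) ≤ Γ₀ a c1 * G1 := by
    have h3 : (2 : ℝ) ^ (a * c1) ≤ 4 := by
      calc (2 : ℝ) ^ (a * c1) ≤ 2 ^ (1 : ℝ) := by gcongr; norm_num
        _ ≤ 4 := by norm_num
    have h4 : 0 < 1 - a * c1 := by linarith
    calc _ ≤ 4 * (a ^ 2 * G1 / (1 - a * c1)) := by gcongr
      _ = _ := by rw [Γ₀]; ring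
  have h5 : ((τ : ℝ) + c₀) ^ (a * c1) * X τ ≤ ((τ : ℝ) + c₀) ^ (a * c1) * (4 * Rθ ^ 2) := by
    gcongr; exact h.X_le τ
  have h6 : ((T : ℝ) + c₀) ^ (a * c1) * X T ≤ ((τ : ℝ) + c₀) ^ (a * c1) * (4 * Rθ ^ 2)
      + (Γ + Γ₀ a c1 * G1) := by
    rw [mul_add] at h1
    linarith
  rw [Real.div_rpow huτ.le huT.le, ← mul_div_assoc, ← add_div,
    le_div_iff₀ (Real.rpow_pos_of_pos huT _)]
  linarith

/-- The error bound for step sizes `a / (t + c₀)`. -/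
theorem le_of_one (h : ErrorRecursion (step a c₀ 1) X Y ρ₀ Rθ c1 c2 G1 G2 τ T)
    (hth : IsThreshold a ρ₀ 1 C b c₀) (ha : 0 < a) (hρ : 0 < ρ₀) (hρ1 : ρ₀ ≤ 1)
    (hτT : τ ≤ T) (hc1 : 0 ≤ c1) (hc1' : c1 < 2 * ρ₀) (hac1 : a * c1 < 1) (hc2 : 0 ≤ c2)
    (hG1 : 0 ≤ G1) (hG2 : 4 ≤ G2) :
    X T ≤ 4 * Rθ ^ 2 * (((τ : ℝ) + c₀) / ((T : ℝ) + c₀)) ^ (a * c1)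
      + (Γ₁ a c₀ ρ₀ c1 c2 G2 τ T + Γ₀ a c1 * G1) / ((T : ℝ) + c₀) ^ (a * c1) := by
  have huτ := hth.shift_pos τ
  have huτ1 := hth.one_le_shift τ
  have h2p : (2 : ℝ) ^ (a * c1) ≤ 4 := by
    calc (2 : ℝ) ^ (a * c1) ≤ 2 ^ (1 : ℝ) := by gcongr; norm_num
      _ ≤ 4 := by norm_num
  have hG2' : 0 ≤ G2 := by linarith
  set q := 2 * ρ₀ * a with hq
  have hq0 : 0 < q := by positivity
  have hYrec : ∀ t, τ ≤ t → t < T → Y (t + 1) ≤ (1 - q / (t + c₀)) * Y t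
      + (G2 - 4) * (ρ₀ * a) ^ 2 / ((t : ℝ) + c₀) ^ 2 := by
    intro t h1 h2
    refine (h.succ_Y t h1 h2).trans (le_of_eq ?_)
    simp only [step, Real.rpow_one]
    rw [hq]
    generalize (t : ℝ) + c₀ = u
    ring
  unfold Γ₁
  -- With `q = 2ρ₀a`, `Y` decays like `u^(-q)`, `log u / u` or `1/u` according as `q < 1`, `q = 1`
  -- or `q > 1`. In the middle case the logarithm is frozen at time `T` and put into `V`. The
  -- condition `ac₁ < r` follows from `c1 < 2ρ₀` in the first case and from `ac₁ < 1` in the others.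
  split_ifs with hlt heq
  · have hq1 : q < 1 := by rw [hq]; linarith
    have h1q : 0 < 1 - q := by linarith
    refine h.le_of_one_of_decay hth ha hτT hc1 hac1 hc2 hG1 (r := q)
      (V := 4 * ((τ : ℝ) + c₀) ^ q + 4 * ρ₀ ^ 2 * a ^ 2 / (1 - q) * G2)
      (by positivity) (by rw [hq]; nlinarith) ?_ (le_of_eq ?_)
    · intro t hτt htT
      have hu := hth.shift_pos t
      have h1 := rpow_mul_le_of_recursion (X := Y) (p := q) (r₁ := 1) (r₂ := 2)
        (E₁ := (G2 - 4) * (ρ₀ * a) ^ 2) (E₂ := 0) hτt hth.two_le hq0.le hq1 (by linarith)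
        (mul_nonneg (by linarith) (sq_nonneg _)) le_rfl h.nonneg_Y (fun i hi hiT => by
          refine (hYrec i hi (by omega)).trans (le_of_eq ?_)
          have hui := hth.shift_pos i
          rw [show (-1 - (1 : ℝ)) = -((2 : ℕ) : ℝ) by norm_num, Real.rpow_neg hui.le,
            Real.rpow_natCast]
          ring)
      rw [Real.rpow_neg hu.le, ← div_eq_mul_inv, le_div_iff₀ (Real.rpow_pos_of_pos hu _),
        mul_comm]
      refine h1.trans (add_le_add ?_ ?_)
      · rw [mul_comm]
        gcongr
        exact h.Y_le τ
      · have h2q : (2 : ℝ) ^ q ≤ 4 := by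
          calc (2 : ℝ) ^ q ≤ 2 ^ (1 : ℝ) := by gcongr; norm_num
            _ ≤ 4 := by norm_num
        calc (2 : ℝ) ^ q * ((G2 - 4) * (ρ₀ * a) ^ 2 / (1 - q) + 0 / (2 - q))
            ≤ 4 * (G2 * (ρ₀ * a) ^ 2 / (1 - q)) := by
              rw [zero_div, add_zero]
              refine mul_le_mul h2q ?_ (div_nonneg (mul_nonneg (by linarith) (sq_nonneg _))
                h1q.le) (by norm_num)
              gcongr
              linarith
          _ = _ := by ring
    · rw [mul_assoc 2 ρ₀ a] at hq
      rw [show 1 - 2 * ρ₀ * a = 1 - q by rw [hq]; ring]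
      ring
  · have hq1 : q = 1 := by rw [hq, mul_assoc, heq]; norm_num
    have hlogT : 0 ≤ Real.log ((T : ℝ) + c₀) := Real.log_nonneg (hth.one_le_shift T)
    have h1p : 0 < 1 - a * c1 := by linarith
    refine h.le_of_one_of_decay hth ha hτT hc1 hac1 hc2 hG1 (r := 1)
      (V := 4 * ((τ : ℝ) + c₀) ^ q + 4 * ρ₀ ^ 2 * a ^ 2 * Real.log ((T : ℝ) + c₀) * G2)
      (by positivity) hac1 ?_ ?_
    · intro t hτt htT
      have hu := hth.shift_pos t
      have h1 := mul_le_add_log_of_recursion (Y := Y) (E := (G2 - 4) * (ρ₀ * a) ^ 2) hτt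
        hth.two_le (mul_nonneg (by linarith) (sq_nonneg _)) h.nonneg_Y
        (fun i hi hiT => by simpa only [hq1] using hYrec i hi (by omega))
      rw [Real.rpow_neg_one, ← div_eq_mul_inv, le_div_iff₀ hu, mul_comm, hq1, Real.rpow_one]
      refine h1.trans (add_le_add ?_ ?_)
      · rw [mul_comm]
        gcongr
        exact h.Y_le τ
      · have hlog : Real.log ((t : ℝ) + c₀) ≤ Real.log ((T : ℝ) + c₀) := by
          have : (t : ℝ) ≤ T := by exact_mod_cast htT
          exact Real.log_le_log hu (by linarith)
        have hlog0 : 0 ≤ Real.log ((t : ℝ) + c₀) := Real.log_nonneg (hth.one_le_shift t)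
        calc 2 * ((G2 - 4) * (ρ₀ * a) ^ 2) * Real.log ((t : ℝ) + c₀)
            ≤ 4 * (G2 * (ρ₀ * a) ^ 2) * Real.log ((T : ℝ) + c₀) := by
              have h3 : 2 * ((G2 - 4) * (ρ₀ * a) ^ 2) ≤ 4 * (G2 * (ρ₀ * a) ^ 2) := by
                nlinarith [sq_nonneg (ρ₀ * a)]
              exact mul_le_mul h3 hlog hlog0 (by positivity)
          _ = _ := by ring
    · calc _ ≤ 4 * (a * c2 * (4 * ((τ : ℝ) + c₀) ^ q
              + 4 * ρ₀ ^ 2 * a ^ 2 * Real.log ((T : ℝ) + c₀) * G2) / (1 - a * c1)) := by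
            gcongr
        _ = _ := by ring
  · have hq1 : 1 < q := by
      rw [hq]
      have : 1 / 2 < ρ₀ * a := lt_of_le_of_ne (not_lt.1 hlt) (Ne.symm heq)
      linarith
    have h1q : 0 < q - 1 := by linarith
    have h1p : 0 < 1 - a * c1 := by linarith
    have hexp : 1 ≤ Real.exp 1 := by linarith [Real.add_one_le_exp (1 : ℝ)]
    refine h.le_of_one_of_decay hth ha hτT hc1 hac1 hc2 hG1 (r := 1)
      (V := 4 * ((τ : ℝ) + c₀) ^ q + 4 * Real.exp 1 * ρ₀ ^ 2 * a ^ 2 / (q - 1) * G2)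
      (by positivity) hac1 ?_ ?_
    · intro t hτt htT
      rw [Real.rpow_neg_one, ← div_eq_mul_inv]
      refine le_div_of_recursion hτt hth.two_le (by positivity) (q := q)
        (E := (G2 - 4) * (ρ₀ * a) ^ 2) (fun i => ?_) ?_ ?_ fun i hi hiT => hYrec i hi (by omega)
      · have h1 := hth.step_le' i
        simp only [step, Real.rpow_one] at h1
        have e : q / (i + c₀) = 2 * ρ₀ * (a / (i + c₀)) := by rw [hq]; ring
        rw [e]
        nlinarith
      · have e : (q - 1) * (4 * ((τ : ℝ) + c₀) ^ q
            + 4 * Real.exp 1 * ρ₀ ^ 2 * a ^ 2 / (q - 1) * G2)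
            = (q - 1) * (4 * ((τ : ℝ) + c₀) ^ q) + 4 * Real.exp 1 * (G2 * (ρ₀ * a) ^ 2) := by
          field_simp
        rw [e]
        have h1 : 0 ≤ (q - 1) * (4 * ((τ : ℝ) + c₀) ^ q) := by positivity
        have h2 : 0 ≤ G2 * (ρ₀ * a) ^ 2 := by positivity
        nlinarith [sq_nonneg (ρ₀ * a)]
      · rw [le_div_iff₀ huτ]
        have h1 : (τ : ℝ) + c₀ ≤ ((τ : ℝ) + c₀) ^ q := Real.self_le_rpow_of_one_le huτ1 hq1.le
        have h2 : 0 ≤ 4 * Real.exp 1 * ρ₀ ^ 2 * a ^ 2 / (q - 1) * G2 := by positivity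
        nlinarith [h.Y_le τ]
    · calc _ ≤ 4 * (a * c2 * (4 * ((τ : ℝ) + c₀) ^ q
              + 4 * Real.exp 1 * ρ₀ ^ 2 * a ^ 2 / (q - 1) * G2) / (1 - a * c1)) := by
            gcongr
        _ = _ := by ring

end ErrorRecursion

/-! ### Condition numbers and assembly. -/

/-- The dependence of the leading coefficient on the condition numbers. -/
lemma leadingCoeff_le {a ρ₀ K L l η η' r Rθ lam G1 G2 : ℝ} (hρ : 0 < ρ₀)
    (hρ1 : ρ₀ ≤ 1) (hK : 1 ≤ K) (hL : 1 ≤ L) (hl : 1 ≤ l) (hη : 0 < η) (hη3 : η ≤ 3)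
    (hη'0 : 0 < η') (hη'1 : η' ≤ 1) (hr0 : 0 ≤ r) (hRθ0 : 0 < Rθ) (hr : r ≤ K)
    (hRθ : Rθ ≤ K / Real.sqrt η') (haK : a ≤ K / η) (hlam : lam ^ 2 = η / (r + 2 * Rθ))
    (hG1 : G1 ≤ 148 * L * l * (r + 3 * Rθ) ^ 2) (hG2 : G2 ≤ 76 * L * l)
    (hG10 : 0 ≤ G1) (hG20 : 0 ≤ G2) :
    a * (G1 + ρ₀ * c₂ r Rθ lam * G2) / c₁ η r Rθ lam
      ≤ 20000 * K ^ 3 * L * l / (η' * η ^ 3) := by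
  have hF : 0 < r + 2 * Rθ := by linarith
  -- The chosen `λ` spends exactly half of `η` in Young's inequality.
  have hc1 : c₁ η r Rθ lam = η / 2 := by
    rw [c₁, hlam]; field_simp; ring
  have hc2 : c₂ r Rθ lam = (r + 2 * Rθ) ^ 2 / η := by
    rw [c₂, hlam]; field_simp
  have hsq : 0 < Real.sqrt η' := Real.sqrt_pos.2 hη'0
  have hsq1 : Real.sqrt η' ≤ 1 := Real.sqrt_le_one.2 hη'1
  have hrK : r ≤ K / Real.sqrt η' := by
    rw [le_div_iff₀ hsq]
    nlinarith
  have hss : (K / Real.sqrt η') ^ 2 = K ^ 2 / η' := by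
    rw [div_pow, Real.sq_sqrt hη'0.le]
  have hF3 : (r + 3 * Rθ) ^ 2 ≤ 16 * (K ^ 2 / η') := by
    rw [← hss]
    calc (r + 3 * Rθ) ^ 2 ≤ (4 * (K / Real.sqrt η')) ^ 2 := by gcongr; linarith
      _ = _ := by ring
  have hF2 : (r + 2 * Rθ) ^ 2 ≤ 9 * (K ^ 2 / η') := by
    rw [← hss]
    calc (r + 2 * Rθ) ^ 2 ≤ (3 * (K / Real.sqrt η')) ^ 2 := by gcongr; linarith
      _ = _ := by ring
  have hB1 : G1 ≤ 2368 * L * l * (K ^ 2 / η') := by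
    calc G1 ≤ _ := hG1
      _ ≤ 148 * L * l * (16 * (K ^ 2 / η')) := by gcongr
      _ = _ := by ring
  have hB2 : ρ₀ * c₂ r Rθ lam * G2 ≤ 684 * L * l * (K ^ 2 / η') / η := by
    rw [hc2]
    calc ρ₀ * ((r + 2 * Rθ) ^ 2 / η) * G2
        ≤ 1 * (9 * (K ^ 2 / η') / η) * (76 * L * l) := by gcongr
      _ = _ := by ring
  -- `η ≤ 3` puts both contributions over `η`: `7104 = 3 · 2368` and `7104 + 684 = 7788`. The
  -- division by `η / 2` doubles this, still below 20000.
  have hB1' : G1 ≤ 7104 * L * l * (K ^ 2 / η') / η := by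
    rw [le_div_iff₀ hη]
    calc G1 * η ≤ 2368 * L * l * (K ^ 2 / η') * 3 := by gcongr
      _ = _ := by ring
  have hc20 : 0 ≤ c₂ r Rθ lam := by rw [hc2]; positivity
  rw [hc1, div_le_div_iff₀ (by positivity) (by positivity)]
  have h1 : a * (G1 + ρ₀ * c₂ r Rθ lam * G2)
      ≤ K / η * (7788 * L * l * (K ^ 2 / η') / η) := by
    gcongr
    calc _ ≤ 7104 * L * l * (K ^ 2 / η') / η + 684 * L * l * (K ^ 2 / η') / η :=
          add_le_add hB1' hB2
      _ = _ := by ring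
  calc a * (G1 + ρ₀ * c₂ r Rθ lam * G2) * (η' * η ^ 3)
      ≤ K / η * (7788 * L * l * (K ^ 2 / η') / η) * (η' * η ^ 3) := by gcongr
    _ = 7788 * (K ^ 3 * L * l * η) := by field_simp
    _ ≤ 10000 * (K ^ 3 * L * l * η) := by gcongr; norm_num
    _ = 20000 * K ^ 3 * L * l * (η / 2) := by ring

end SingleChainTD

theorem theoremt :
    ∃ M : ℝ, 0 < M ∧
    ∀ (a ρ₀ ξ C b : ℝ), 0 < a → 0 < ρ₀ → ρ₀ ≤ 1 → 0 < ξ → ξ ≤ 1 → 1 < C → 0 ≤ b → b < 1 →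
    ∃ cbar : ℝ, 0 < cbar ∧
    ∀ (S A : Type*) [Fintype S] [DecidableEq S] [Fintype A] (d : ℕ) (m : Model S A d)
      (μ : S → ℝ) (θstar : EuclideanSpace ℝ (Fin d)) (Rw Rθ lam : ℝ),
      m.P.IsIrreducible → IsAperiodic m.P → IsStationaryDist m.P μ →
      (∀ (k : ℕ) (s : S), mixDist m.P μ k s ≤ C * b ^ k) →
      m.GoodFeatures → m.IsFixedPoint μ θstar →
      1 ≤ Rw → 0 < Rθ → ‖θstar‖ ≤ Rθ → 0 < lam →
    ∀ (c₀ : ℝ), cbar ≤ c₀ →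
    ∀ (Ω : Type*) [MeasurableSpace Ω] (ℙ : Measure Ω) [IsProbabilityMeasure ℙ]
      (s : ℕ → Ω → S), IsMarkovChain m.P ℙ s →
    ∀ (w₀ θ₀ : EuclideanSpace ℝ (Fin d)), ‖w₀‖ ≤ 1 → ‖θ₀‖ ≤ Rθ →
    ∀ (τ T : ℕ), mixingTime m.P μ (ρ₀ * step a c₀ ξ T) ≤ τ → τ ≤ T →
    ∀ (η c1 c2 G1 G2 err : ℝ), η = m.eta μ →
      c1 = c₁ η m.rMax Rθ lam → c2 = c₂ m.rMax Rθ lam →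
      G1 = G₁ a c₀ ρ₀ C b m.rMax Rθ T → G2 = G₂ a c₀ ρ₀ C b T →
      err = ∫ ω, ‖(m.iterates (step a c₀ ξ) (fun t => ρ₀ * step a c₀ ξ t) Rw Rθ
        w₀ θ₀ (fun t => s t ω) T).2 - θstar‖ ^ 2 ∂ℙ →
      -- the case `0 < ξ < 1`
      (ξ < 1 → lam ^ 2 < 2 * η / (m.rMax + 2 * Rθ) →
        max ((ξ / (a * c1)) ^ (1 / (1 - ξ))) ((ξ / (ρ₀ * a)) ^ (1 / (1 - ξ))) ≤ c₀ →
        err ≤ 4 * Rθ ^ 2 * Real.exp (-(a * c1 / (1 - ξ)) * Δ c₀ ξ τ T)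
          + a * (G1 + ρ₀ * c2 * G2) / (c1 * ((T : ℝ) + c₀) ^ ξ)
          + 4 * a * c2 / (1 - ξ) * Real.exp (a * c1 / c₀ ^ ξ) * Δ c₀ ξ τ T
              * Real.exp (-(a / (1 - ξ)) * min c1 (2 * ρ₀) * Δ c₀ ξ τ T)) ∧
      -- the case `ξ = 1`
      (ξ = 1 → a * η < 1 → lam ^ 2 ≤ 2 * η / (m.rMax + 2 * Rθ) →
        (2 * η - 4 * ρ₀) / (m.rMax + 2 * Rθ) < lam ^ 2 →
        err ≤ 4 * Rθ ^ 2 * (((τ : ℝ) + c₀) / ((T : ℝ) + c₀)) ^ (a * c1)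
          + (Γ₁ a c₀ ρ₀ c1 c2 G2 τ T + Γ₀ a c1 * G1) / ((T : ℝ) + c₀) ^ (a * c1)) ∧
      -- dependence of the coefficient of `(T + c₀)^(-ξ)` on the condition numbers
      (∀ K : ℝ, 1 ≤ K → lam ^ 2 = η / (m.rMax + 2 * Rθ) → m.rMax ≤ K →
        Rθ ≤ K / Real.sqrt (m.eta' μ) → a ≤ K / η →
        a * (G1 + ρ₀ * c2 * G2) / c1
            ≤ M * K ^ 3 * L₁ C b * (Real.log ((T : ℝ) + c₀) - Real.log (ρ₀ * a) + 1)
              / (m.eta' μ * η ^ 3) ∧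
        (η ≤ K * m.eta' μ →
          a * (G1 + ρ₀ * c2 * G2) / c1
            ≤ M * K ^ 4 * L₁ C b * (Real.log ((T : ℝ) + c₀) - Real.log (ρ₀ * a) + 1)
              / η ^ 4)) := by
  refine ⟨20000, by norm_num, ?_⟩
  intro a ρ₀ ξ C b ha hρ hρ1 hξ hξ1 hC hb0 hb1
  obtain ⟨cbar, hcbar⟩ := exists_isThreshold (a := a) (ρ₀ := ρ₀) (C := C) (b := b) hξ
  refine ⟨cbar, by linarith [hcbar.two_le], ?_⟩
  intro S A _ _ _ d m μ θstar Rw Rθ lam _ _ hμ hmix hf hfix hRw hRθ hθ hlam c₀ hc₀ Ω _ ℙ _ s hs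
    w₀ θ₀ hw₀ hθ₀ τ T hτ hτT η c1 c2 G1 G2 err hη hc1 hc2 hG1 hG2 herr
  have hth := hcbar.mono hc₀
  have hrun : m.IsRun ρ₀ (step a c₀ ξ) Rw Rθ w₀ θ₀ :=
    ⟨hf, hρ.le, hρ1, fun t => (hth.step_pos ha t).le, fun t => by linarith [hth.step_le' t],
      hth.step_antitone ha hξ, hRw, hRθ, hw₀, hθ₀⟩
  have hrec := errorRecursion hth ha hρ hρ1 hξ hξ1 hC hb0 hb1 hμ hmix hfix hθ hlam hrun hs hτ
  have hr := m.rMax_nonneg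
  have hF : 0 < m.rMax + 2 * Rθ := by linarith
  have hη0 : 0 ≤ η := hη ▸ Model.eta_nonneg hμ
  have hη3 : η ≤ 3 := hη ▸ Model.eta_le_three hμ hf
  have hG10 : 0 ≤ G1 := hG1 ▸ G₁_nonneg hth ha hρ hρ1 T
  have hG24 : 4 ≤ G2 := hG2 ▸ four_le_G₂ hth ha hρ hρ1 T
  have hc20 : 0 ≤ c2 := by rw [hc2, c₂]; positivity
  have hc1η : c1 ≤ η := by
    rw [hc1, c₁]
    linarith [show 0 ≤ lam ^ 2 * (m.rMax + 2 * Rθ) / 2 by positivity]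
  rw [← hη, ← hc1, ← hc2, ← hG1, ← hG2] at hrec
  refine ⟨fun hξlt hlam2 hmax => ?_, fun hξeq haη hlam2 hlam2' => ?_,
    fun K hK hlam2 hrK hRK haK => ?_⟩
  · rw [lt_div_iff₀ hF] at hlam2
    have hc1pos : 0 < c1 := by rw [hc1, c₁]; linarith
    rw [herr]
    exact hrec.le_of_lt_one hth ha hρ hρ1 hξ hξlt hτT hc1pos (hc1η.trans hη3) hc20 hG10 hG24 hmax
  · subst hξeq
    rw [le_div_iff₀ hF] at hlam2
    rw [div_lt_iff₀ hF] at hlam2'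
    have hc1nn : 0 ≤ c1 := by rw [hc1, c₁]; linarith
    have hc1lt : c1 < 2 * ρ₀ := by rw [hc1, c₁]; linarith
    have hac1 : a * c1 < 1 := (mul_le_mul_of_nonneg_left hc1η ha.le).trans_lt haη
    rw [herr]
    exact hrec.le_of_one hth ha hρ hρ1 hτT hc1nn hc1lt hac1 hc20 hG10 hG24
  -- Positivity of `η` comes from `λ > 0`; that of `η'` from `Rθ > 0`, since `η' = 0` would turn `K
  -- / √η'` into the default value 0.
  · have hηpos : 0 < η := by
      have h1 : 0 < η / (m.rMax + 2 * Rθ) := hlam2 ▸ pow_pos hlam 2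
      exact (div_pos_iff_of_pos_right hF).1 h1
    have hη'1 := Model.eta'_le_one hμ hf
    have hη'0 : 0 < m.eta' μ := by
      refine lt_of_le_of_ne (Model.eta'_nonneg hμ) fun h0 => ?_
      rw [← h0, Real.sqrt_zero, div_zero] at hRK
      linarith
    have hL := one_le_L₁ C b
    have hl1 := hth.log_shift_sub_nonneg ha hρ hρ1 T
    have hlog : Real.log (ρ₀ * a) ≤ Real.log a :=
      Real.log_le_log (by positivity) (mul_le_of_le_one_left ha.le hρ1)
    set L := L₁ C b with hLdef
    set l := Real.log ((T : ℝ) + c₀) - Real.log (ρ₀ * a) + 1 with hl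
    have hl1' : 1 ≤ l := by linarith
    have hLl : 1 ≤ L * l := one_le_mul_of_one_le_of_one_le hL hl1'
    -- Using `L l ≥ 1`: `148 = 4(28 + 8) + 4`, and `76 = 64 + 12` for `G2`.
    have hB1 : G1 ≤ 148 * L * l * (m.rMax + 3 * Rθ) ^ 2 := by
      rw [hG1, G₁]
      refine mul_le_mul_of_nonneg_right ?_ (sq_nonneg _)
      have h0 := log_sub_log_nonneg hth ha hρ hρ1 T
      have h1 : 4 * (28 + 8 * ρ₀) * L₁ C b * (Real.log ((T : ℝ) + c₀) - Real.log a + 1)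
          ≤ 4 * (28 + 8 * 1) * L * l := by
        gcongr
        linarith
      linarith
    have hB2 : G2 ≤ 76 * L * l := by
      rw [hG2, G₂]
      linarith
    have hmain : a * (G1 + ρ₀ * c2 * G2) / c1 ≤ 20000 * K ^ 3 * L * l / (m.eta' μ * η ^ 3) := by
      rw [hc1, hc2]
      exact leadingCoeff_le hρ hρ1 hK hL hl1' hηpos hη3 hη'0 hη'1 hr hRθ hrK hRK haK hlam2 hB1
        hB2 hG10 (by linarith)
    refine ⟨hmain, fun hηK => hmain.trans ?_⟩
    rw [div_le_div_iff₀ (by positivity) (by positivity)]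
    calc 20000 * K ^ 3 * L * l * η ^ 4 = 20000 * K ^ 3 * L * l * η ^ 3 * η := by ring
      _ ≤ 20000 * K ^ 3 * L * l * η ^ 3 * (K * m.eta' μ) := by gcongr
      _ = _ := by ring
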